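/- Conventions. Let $(\Omega,\mathcal F,P)$ be a probability space. For $T\in[0,1]$ and processes $Y$, $X$ on $[0,T]$ with paths in $L^1([0,T])$ and $C^0([0,T])$ respectively ($X$ being extended by $X_s=X_T$ for $s>T$), $Y$ is *$X$-forward integrable on $[0,T]$* if $\frac1\varepsilon\int_0^t Y_s(X_{s+\varepsilon}-X_s)\,ds$ converges in probability as $\varepsilon\downarrow0$ for every $t\in[0,T]$ and the limit has a continuous version, denoted $\int_0^\cdot Y\,d^-X$. The quadratic variation $[X]$ is the limit, uniformly in $t\in[0,1]$ in probability, of $\frac1\varepsilon\int_0^t(X_{s+\varepsilon}-X_s)^2ds$. $Y$ is *locally $X$-forward integrable on $[0,1)$* if $Y\mathbf 1_{[0,t]}$ is $X$-forward integrable on $[0,1]$ for every $t<1$; the integrals then define a continuous process $\int_0^\cdot Y\,d^-X$ on $[0,1)$, and $Y$ is *$X$-improperly forward integrable* if moreover this process has a.s. a finite limit as $t\to1$. Let $\mathbb G=(\mathcal G_t)_{t\in[0,1]}$ be a filtration, $S$ a $\mathbb G$-adapted, continuous, strictly positive process on $[0,1]$ (not necessarily a semimartingale), $r>0$, $V_t=rt$,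 $S^0_t=e^{V_t}$, and $\widetilde Y_t=e^{-rt}Y_t$ for a process $Y$. Suppose that for some $\sigma:[0,1]\times(0,\infty)\to\mathbb R$, almost surely $\int_0^1\sigma(s,S_s)^2S_s^2\,ds<\infty$, and that $S$ has quadratic variation $[S]_t=\int_0^t\sigma(s,S_s)^2S_s^2\,ds$. A *self-financing portfolio* is a pair $(X_0,h)$ with $X_0$ $\mathcal G_0$-measurable and $h=(h_t)_{0\le t<1}$ $\mathbb G$-adapted, with left-continuous paths bounded on compact subsets of $[0,1)$, and locally $S$-forward integrable. Its wealth process $X$ on $[0,1)$ is given by $$\widetilde X=X_0-\int_0^\cdot e^{-V_t}h_tS_t\,dV_t+\int_0^\cdot e^{-V_t}\,d^-\!\int_0^t h_s\,d^-S_s ,$$ and $(X_0,h)$ *replicates* a random variable $C$ if $\lim_{t\to1}X_t=C$ almost surely. **Proposition.** Let $\psi\in C^0(\mathbb R)$, and let $v\in C^{1,2}([0,1)\times\mathbb R)\cap C^0([0,1]\times\mathbb R)$ satisfy $$\partial_tv(t,y)+\tfrac12\,\widetilde\sigma(t,y)^2y^2\,\partial^{(2)}_{yy}v(t,y)=0\quad\text{for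 } (t,y)\in[0,1)\times(0,\infty),\qquad v(1,y)=\widetilde\psi(y)\quad\text{for } y\in\mathbb R,$$ where $\widetilde\sigma(t,y)=\sigma(t,ye^{rt})$ and $\widetilde\psi(y)=\psi(ye^{r})e^{-r}$. Set $h_t=\partial_yv(t,\widetilde S_t)$ for $0\le t<1$ and $X_0=v(0,S_0)$. Then $(X_0,h)$ is a self-financing portfolio that replicates $\psi(S_1)$. Moreover, $h$ is $\widetilde S$-improperly forward integrable, and $h$ is $S$-improperly forward integrable if and only if $\lim_{t\to1}\int_0^t h_sS_s\,ds$ exists and is finite almost surely. -/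

import Mathlib

open MeasureTheory Filter Topology Set

namespace ForwardCalculus

variable {Ω : Type*} {mΩ : MeasurableSpace Ω}

/-- The regularization `(1/ε) ∫₀ᵗ Y_s (X_{s+ε} - X_s) ds` of the forward integral on `[0,T]`. The
integrator is extended beyond `T` by its value at `T`. -/
noncomputable def forwardApprox (T ε : ℝ) (Y X : ℝ → Ω → ℝ) (t : ℝ) (ω : Ω) : ℝ :=
  (1 / ε) * ∫ s in (0 : ℝ)..t, Y s ω * (X (min (s + ε) T) ω - X (min s T) ω)

/-- The regularization `(1/ε) ∫₀ᵗ (Y_{s+ε} - Y_s) (X_{s+ε} - X_s) ds` of the covariation on `[0,T]`,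
both processes being extended beyond `T` by their values at `T`. -/
noncomputable def covariationApprox (T ε : ℝ) (X Y : ℝ → Ω → ℝ) (t : ℝ) (ω : Ω) : ℝ :=
  (1 / ε) * ∫ s in (0 : ℝ)..t,
    (Y (min (s + ε) T) ω - Y (min s T) ω) * (X (min (s + ε) T) ω - X (min s T) ω)

/-- Uniform convergence in probability on `[0,T]` as `ε → 0+`. The event in the
definition is `{sup_{t ∈ [0,T]} |X^ε_t - L_t| > δ}`. -/
def TendstoUcp (P : Measure Ω) (T : ℝ) (X : ℝ → ℝ → Ω → ℝ) (L : ℝ → Ω → ℝ) : Prop :=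
  ∀ δ : ℝ, 0 < δ →
    Tendsto (fun ε : ℝ => P {ω | ∃ t ∈ Icc (0 : ℝ) T, δ < |X ε t ω - L t ω|}) (𝓝[>] 0) (𝓝 0)

/-- The process `C` is the covariation process `[X,Y]` on `[0,T]`. -/
def IsCovariation (P : Measure Ω) (T : ℝ) (X Y C : ℝ → Ω → ℝ) : Prop :=
  TendstoUcp P T (fun ε => covariationApprox T ε X Y) C

/-- `Y` is `X`-forward integrable on `[0,T]`, and the process `I` is (a continuous version of) the
forward integral `∫₀^· Y d⁻X`: the regularizations converge in probability at every time. -/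
structure IsForwardIntegral (P : Measure Ω) (T : ℝ) (Y X I : ℝ → Ω → ℝ) : Prop where
  continuousOn_integrator : ∀ ω, ContinuousOn (fun t => X t ω) (Icc 0 T)
  integrable_integrand : ∀ ω, IntervalIntegrable (fun t => Y t ω) volume 0 T
  continuousOn_integral : ∀ ω, ContinuousOn (fun t => I t ω) (Icc 0 T)
  tendsto : ∀ t ∈ Icc (0 : ℝ) T,
    TendstoInMeasure P (fun ε => forwardApprox T ε Y X t) (𝓝[>] (0 : ℝ)) (I t)

/-- The process `Y 1_{[0,t]}`. -/
noncomputable def cutAt (Y : ℝ → Ω → ℝ) (t : ℝ) : ℝ → Ω → ℝ :=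
  fun s ω => (Icc (0 : ℝ) t).indicator (fun u => Y u ω) s

/-- `Y = (Y_t, 0 ≤ t < T)` is locally `X`-forward integrable on `[0,T)`, with forward integral the
process `I`, continuous on `[0,T)`: for every `t < T` the process `Y 1_{[0,t]}` is `X`-forward
integrable on `[0,T]`, and its forward integral coincides with `I` on `[0,t]`. -/
def IsLocalForwardIntegral (P : Measure Ω) (T : ℝ) (Y X I : ℝ → Ω → ℝ) : Prop :=
  (∀ ω, ContinuousOn (fun t => I t ω) (Ico 0 T)) ∧
  ∀ t ∈ Ico (0 : ℝ) T, ∃ K : ℝ → Ω → ℝ,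
    IsForwardIntegral P T (cutAt Y t) X K ∧ ∀ᵐ ω ∂P, ∀ s ∈ Icc (0 : ℝ) t, K s ω = I s ω

/-- `Y` is locally `X`-forward integrable on `[0,T)`. -/
def LocallyForwardIntegrable (P : Measure Ω) (T : ℝ) (Y X : ℝ → Ω → ℝ) : Prop :=
  ∃ I : ℝ → Ω → ℝ, IsLocalForwardIntegral P T Y X I

/-- `Y` is `X`-improperly forward integrable on `[0,T]`. -/
def ImproperlyForwardIntegrable (P : Measure Ω) (T : ℝ) (Y X : ℝ → Ω → ℝ) : Prop :=
  ∃ I : ℝ → Ω → ℝ, IsLocalForwardIntegral P T Y X I ∧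
    ∀ᵐ ω ∂P, ∃ l : ℝ, Tendsto (fun t => I t ω) (𝓝[<] T) (𝓝 l)

/-- The set `C_b⁻([0,1))`: every path is left continuous on `[0,1)` and bounded on each compact
subset of `[0,1)`. -/
def LeftContLocBdd (h : ℝ → Ω → ℝ) : Prop :=
  ∀ ω, (∀ t ∈ Ico (0 : ℝ) 1, ContinuousWithinAt (fun s => h s ω) (Icc 0 t) t) ∧
    ∀ T ∈ Ico (0 : ℝ) 1, ∃ C : ℝ, ∀ t ∈ Icc (0 : ℝ) T, |h t ω| ≤ C

/-- The discounted process `e^{-rt} Y_t`. -/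
noncomputable def discounted (r : ℝ) (Y : ℝ → Ω → ℝ) : ℝ → Ω → ℝ :=
  fun t ω => Real.exp (-(r * t)) * Y t ω

/-- `(X₀, h)` is a self-financing portfolio for the price process `S` and the information flow `𝓖`:
`X₀` is `𝓖₀`-measurable, and `h` is `𝓖`-adapted, lies in `C_b⁻([0,1))` and is locally
`S`-forward integrable. -/
structure IsSelfFinancingPortfolio (P : Measure Ω)
    (𝓖 : Filtration (Icc (0 : ℝ) 1) mΩ)
    (S : ℝ → Ω → ℝ) (X₀ : Ω → ℝ) (h : ℝ → Ω → ℝ) : Prop where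
  measurable_initial : Measurable[𝓖 ⟨0, by simp⟩] X₀
  adapted : ∀ t : Icc (0 : ℝ) 1, (t : ℝ) < 1 → Measurable[𝓖 t] (h t)
  leftContLocBdd : LeftContLocBdd h
  locallyForwardIntegrable : LocallyForwardIntegrable P 1 h S

/-- `X` is the wealth process, on `[0,1)`, of the self-financing portfolio `(X₀, h)` when the price of
the less risky asset is `S⁰_t = e^{V_t}` with `V_t = r t`. Its discounted value `X̃_t = e^{-rt} X_t` is
`X̃ = X₀ - ∫₀^· e^{-V_t} h_t S_t dV_t + ∫₀^· e^{-V_t} d⁻ Z_t`, where `Z = ∫₀^· h_s d⁻S_s`. The process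
`Z` lives on `[0,1)`, so the integral `J` against `Z` is taken on every `[0,T]` with `T < 1`. -/
def IsWealthProcess (P : Measure Ω) (r : ℝ) (S : ℝ → Ω → ℝ) (X₀ : Ω → ℝ) (h X : ℝ → Ω → ℝ) : Prop :=
  ∃ Z J : ℝ → Ω → ℝ,
    IsLocalForwardIntegral P 1 h S Z ∧
    (∀ T ∈ Ico (0 : ℝ) 1, IsForwardIntegral P T (fun t _ => Real.exp (-(r * t))) Z J) ∧
    ∀ᵐ ω ∂P, ∀ t ∈ Ico (0 : ℝ) 1,
      discounted r X t ω =
        X₀ ω - (∫ s in (0 : ℝ)..t, Real.exp (-(r * s)) * h s ω * S s ω * r) + J t ω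

/-- The portfolio `(X₀, h)` replicates the contingent claim `C`: its wealth process converges almost
surely to `C` as `t → 1`. -/
def Replicates (P : Measure Ω) (r : ℝ) (S : ℝ → Ω → ℝ) (X₀ : Ω → ℝ) (h : ℝ → Ω → ℝ)
    (C : Ω → ℝ) : Prop :=
  ∃ X : ℝ → Ω → ℝ, IsWealthProcess P r S X₀ h X ∧
    ∀ᵐ ω ∂P, Tendsto (fun t => X t ω) (𝓝[<] 1) (𝓝 (C ω))

/-- `∂_t v(t,y)`, for `t ∈ [0,1)` (one-sided at `t = 0`). -/
noncomputable def dt (v : ℝ → ℝ → ℝ) (t y : ℝ) : ℝ :=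
  derivWithin (fun s => v s y) (Ico 0 1) t

/-- `∂_y v(t,y)`. -/
noncomputable def dy (v : ℝ → ℝ → ℝ) (t y : ℝ) : ℝ := deriv (v t) y

/-- `∂²_{yy} v(t,y)`. -/
noncomputable def dyy (v : ℝ → ℝ → ℝ) (t y : ℝ) : ℝ := deriv (deriv (v t)) y

/-- `v` is of class `C^{1,2}` on `[0,1) × ℝ`: the derivatives `∂_t v`, `∂_y v`, `∂²_{yy} v` exist there,
and they are jointly continuous, as is `v` itself. -/
structure IsC12 (v : ℝ → ℝ → ℝ) : Prop where
  differentiable_t : ∀ y, DifferentiableOn ℝ (fun t => v t y) (Ico 0 1)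
  differentiable_y : ∀ t ∈ Ico (0 : ℝ) 1, Differentiable ℝ (v t)
  differentiable_yy : ∀ t ∈ Ico (0 : ℝ) 1, Differentiable ℝ (deriv (v t))
  continuousOn : ContinuousOn (fun p : ℝ × ℝ => v p.1 p.2) (Ico 0 1 ×ˢ univ)
  continuousOn_dt : ContinuousOn (fun p : ℝ × ℝ => dt v p.1 p.2) (Ico 0 1 ×ˢ univ)
  continuousOn_dy : ContinuousOn (fun p : ℝ × ℝ => dy v p.1 p.2) (Ico 0 1 ×ˢ univ)
  continuousOn_dyy : ContinuousOn (fun p : ℝ × ℝ => dyy v p.1 p.2) (Ico 0 1 ×ˢ univ)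

end ForwardCalculus

namespace ForwardCalculus

/-! The discounted value of the claim should be V_t = v(t, S̃_t), and this follows from a pathwise
Itô formula that needs only the quadratic variation of S. Uniform convergence in probability of the
regularized quadratic variation, with Borel–Cantelli, gives from any sequence ε → 0 a subsequence
along which it converges at all times, almost surely (`TendstoUcp.exists_subseq_ae`). On such a path
the densities (x_{s+ε} - x_s)²/ε are nonnegative and their primitives converge, so they converge
weakly (`tendsto_integral_mul_of_tendsto_primitive`). This handles the quadratic Taylor term in
`tendsto_forward_ito` and bounds the remainder.

The density of [S̃] is e^{-2rs} times that of [S], so the backward equation cancels the time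
derivative against the second-order term. Hence ∫ h d⁻S̃ = V - V_0, and the product rule for e^{rs}
S̃ gives (`tendsto_forwardApprox_of_path`) Z_t = ∫_0^t h d⁻S = e^{rt} V_t - V_0 - r ∫_0^t e^{rs} V_s
ds + r ∫_0^t h_s S_s ds. The subsequence criterion turns these pathwise limits into limits in
probability.

Integrating e^{-rs} against Z gives V_t - V_0 + r ∫_0^t e^{-rs} h_s S_s ds
(`tendsto_forwardApprox_discount`). The drift term of the wealth equation removes the last integral,
so the wealth is e^{rt} V_t, which tends to ψ(S_1) because v is continuous up to time 1. The same
continuity makes every term of Z except r ∫ h S converge at time 1; as r > 0, this is the stated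
equivalence. -/

/-! ### Weak convergence of densities whose primitives converge -/

theorem abs_integral_mul_sub_sum_le {t η : ℝ} (ht : 0 ≤ t) {n : ℕ} (hn : 0 < n) {g q : ℝ → ℝ}
    (hg : Continuous g) (hq : IntervalIntegrable q volume 0 t) (hq0 : ∀ s, 0 ≤ q s)
    (hosc : ∀ s ∈ Icc 0 t, ∀ s' ∈ Icc 0 t, |s - s'| ≤ t / n → |g s - g s'| ≤ η) :
    |(∫ s in (0 : ℝ)..t, g s * q s) - ∑ k ∈ Finset.range n, g (t * k / n) *
      ((∫ s in (0 : ℝ)..(t * (k + 1 : ℕ) / n), q s) - ∫ s in (0 : ℝ)..(t * k / n), q s)|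
      ≤ η * ∫ s in (0 : ℝ)..t, q s := by
  have hn' : (0 : ℝ) < n := by exact_mod_cast hn
  set p : ℕ → ℝ := fun k => t * k / n with hp
  have hp0 : p 0 = 0 := by simp [hp]
  have hpn : p n = t := by simp only [hp]; field_simp
  have hmono : ∀ k, p k ≤ p (k + 1) := by
    intro k
    simp only [hp]
    gcongr
    simp
  have hpm : Monotone p := monotone_nat_of_le_succ hmono
  have hmem : ∀ k ≤ n, p k ∈ Icc 0 t := fun k hk =>
    ⟨hp0 ▸ hpm (Nat.zero_le k), hpn ▸ hpm hk⟩
  have hsub : ∀ k < n, uIcc (p k) (p (k + 1)) ⊆ uIcc 0 t := fun k hk => by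
    rw [uIcc_of_le (hmono k), uIcc_of_le ht]
    exact Icc_subset_Icc (hmem k hk.le).1 (hmem (k + 1) hk).2
  have hqk : ∀ k < n, IntervalIntegrable q volume (p k) (p (k + 1)) := fun k hk =>
    hq.mono_set (hsub k hk)
  have hgq : ∀ k < n, IntervalIntegrable (fun s => g s * q s) volume (p k) (p (k + 1)) :=
    fun k hk => (hqk k hk).continuousOn_mul hg.continuousOn
  have hdiff : ∀ k < n, (∫ s in (0 : ℝ)..p (k + 1), q s) - (∫ s in (0 : ℝ)..p k, q s)
      = ∫ s in p k..p (k + 1), q s := fun k hk => by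
    have h1 : ∀ j ≤ n, IntervalIntegrable q volume 0 (p j) := fun j hj => hq.mono_set (by
      rw [uIcc_of_le ht, uIcc_of_le (hmem j hj).1]
      exact Icc_subset_Icc le_rfl (hmem j hj).2)
    exact intervalIntegral.integral_interval_sub_left (h1 _ hk) (h1 _ hk.le)
  have e1 : (∫ s in (0 : ℝ)..t, g s * q s)
      = ∑ k ∈ Finset.range n, ∫ s in p k..p (k + 1), g s * q s := by
    rw [intervalIntegral.sum_integral_adjacent_intervals hgq, hp0, hpn]
  have e2 : (∫ s in (0 : ℝ)..t, q s) = ∑ k ∈ Finset.range n, ∫ s in p k..p (k + 1), q s := by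
    rw [intervalIntegral.sum_integral_adjacent_intervals hqk, hp0, hpn]
  rw [e1, e2, ← Finset.sum_sub_distrib, Finset.mul_sum]
  refine (Finset.abs_sum_le_sum_abs _ _).trans (Finset.sum_le_sum fun k hk => ?_)
  have hk := Finset.mem_range.1 hk
  change |(∫ s in p k..p (k + 1), g s * q s) - g (p k) *
    ((∫ s in (0 : ℝ)..p (k + 1), q s) - ∫ s in (0 : ℝ)..p k, q s)| ≤ _
  rw [hdiff k hk, ← intervalIntegral.integral_const_mul, ← intervalIntegral.integral_sub
    (hgq k hk) ((hqk k hk).const_mul _), ← intervalIntegral.integral_const_mul, ← Real.norm_eq_abs]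
  refine intervalIntegral.norm_integral_le_of_norm_le (hmono k)
    (ae_of_all _ fun s hs => ?_) ((hqk k hk).const_mul _)
  rw [← sub_mul, norm_mul, Real.norm_eq_abs, Real.norm_eq_abs, abs_of_nonneg (hq0 s)]
  refine mul_le_mul_of_nonneg_right (hosc _ ?_ _ (hmem k hk.le) ?_) (hq0 s)
  · exact ⟨(hmem k hk.le).1.trans hs.1.le, hs.2.trans (hmem (k + 1) hk).2⟩
  · rw [abs_of_nonneg (by linarith [hs.1])]
    have : p (k + 1) - p k = t / n := by simp only [hp]; push_cast; ring
    linarith [hs.2]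

/-- Convergence of the primitives gives convergence of each Stieltjes sum on a fixed grid.
Nonnegativity keeps the masses bounded, so the grid error is small uniformly in ε. -/
theorem tendsto_integral_mul_of_tendsto_primitive {l : Filter ℝ} {t : ℝ} (ht : 0 ≤ t)
    {q : ℝ → ℝ → ℝ} {a g : ℝ → ℝ}
    (hq : ∀ᶠ ε in l, IntervalIntegrable (q ε) volume 0 t ∧ ∀ s, 0 ≤ q ε s)
    (ha : IntervalIntegrable a volume 0 t) (ha0 : ∀ s, 0 ≤ a s) (hg : Continuous g)
    (hlim : ∀ u ∈ Icc 0 t,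
      Tendsto (fun ε => ∫ s in (0 : ℝ)..u, q ε s) l (𝓝 (∫ s in (0 : ℝ)..u, a s))) :
    Tendsto (fun ε => ∫ s in (0 : ℝ)..t, g s * q ε s) l (𝓝 (∫ s in (0 : ℝ)..t, g s * a s)) := by
  set A := ∫ s in (0 : ℝ)..t, a s
  have hA : 0 ≤ A := intervalIntegral.integral_nonneg ht fun s _ => ha0 s
  rw [Metric.tendsto_nhds]
  intro δ hδ
  -- The masses are A for the limit and eventually less than A + 1 for `q ε`, so the two grid errors
  -- add up to less than η(2A + 2) = δ/2. The other δ/2 is for the sums.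
  set η := δ / (2 * (2 * A + 2)) with hη
  have hη0 : 0 < η := by positivity
  obtain ⟨ρ, hρ, hunif⟩ := Metric.uniformContinuousOn_iff.1
    ((isCompact_Icc (a := (0 : ℝ)) (b := t)).uniformContinuousOn_of_continuous hg.continuousOn)
    η hη0
  obtain ⟨n, hn⟩ := exists_nat_gt (max (t / ρ) 0)
  have hn0 : (0 : ℝ) < n := lt_of_le_of_lt (le_max_right _ _) hn
  have hosc : ∀ s ∈ Icc 0 t, ∀ s' ∈ Icc 0 t, |s - s'| ≤ t / n → |g s - g s'| ≤ η := by
    intro s hs s' hs' h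
    refine (hunif s hs s' hs' (lt_of_le_of_lt h ?_)).le
    rw [div_lt_iff₀ hn0, mul_comm, ← div_lt_iff₀ hρ]
    exact lt_of_le_of_lt (le_max_left _ _) hn
  have hnn : 0 < n := by exact_mod_cast hn0
  have hmem : ∀ k ≤ n, t * k / n ∈ Icc 0 t := fun k hk => by
    have : (k : ℝ) ≤ n := by exact_mod_cast hk
    refine ⟨by positivity, ?_⟩
    rw [div_le_iff₀ hn0]
    gcongr
  have hsum : Tendsto (fun ε => ∑ k ∈ Finset.range n, g (t * k / n) *
      ((∫ s in (0 : ℝ)..(t * (k + 1 : ℕ) / n), q ε s) - ∫ s in (0 : ℝ)..(t * k / n), q ε s)) l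
      (𝓝 (∑ k ∈ Finset.range n, g (t * k / n) *
      ((∫ s in (0 : ℝ)..(t * (k + 1 : ℕ) / n), a s) - ∫ s in (0 : ℝ)..(t * k / n), a s))) := by
    refine tendsto_finsetSum _ fun k hk => ?_
    have hk := Finset.mem_range.1 hk
    exact ((hlim _ (hmem _ hk)).sub (hlim _ (hmem _ hk.le))).const_mul _
  have ea := abs_integral_mul_sub_sum_le ht hnn hg ha ha0 hosc
  filter_upwards [hq, Metric.tendsto_nhds.1 hsum (δ / 2) (half_pos hδ),
    (hlim t ⟨ht, le_rfl⟩).eventually (gt_mem_nhds (lt_add_one A))] with ε hε h1 h2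
  have eq := abs_integral_mul_sub_sum_le ht hnn hg hε.1 hε.2 hosc
  rw [Real.dist_eq] at h1 ⊢
  have h3 : η * ∫ s in (0 : ℝ)..t, q ε s < η * (A + 1) := mul_lt_mul_of_pos_left h2 hη0
  have h4 : η * (A + 1) + η * A + η = δ / 2 := by rw [hη]; field_simp; ring
  rw [abs_le] at ea eq
  rw [abs_lt] at h1 ⊢
  constructor <;> linarith [ea.1, ea.2, eq.1, eq.2, h1.1, h1.2]

/-! ### Limits of averaged increments -/

/-- Averages of the increments of a continuous function. -/
theorem tendsto_average_increment {g : ℝ → ℝ} (hg : Continuous g) (t : ℝ) :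
    Tendsto (fun ε : ℝ => (1 / ε) * ∫ s in (0 : ℝ)..t, (g (s + ε) - g s)) (𝓝[>] 0)
      (𝓝 (g t - g 0)) := by
  have key : ∀ u : ℝ, Tendsto (fun ε : ℝ => ε⁻¹ * ∫ s in u..(u + ε), g s) (𝓝[>] 0) (𝓝 (g u)) := by
    intro u
    have h1 : HasDerivAt (fun x => ∫ s in u..x, g s) (g u) u :=
      intervalIntegral.integral_hasDerivAt_right (by simp) (hg.stronglyMeasurableAtFilter _ _)
        hg.continuousAt
    simpa using h1.tendsto_slope_zero_right
  refine ((key t).sub (key 0)).congr fun ε => ?_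
  have hi : ∀ a b, IntervalIntegrable g volume a b := fun a b => hg.intervalIntegrable a b
  rw [intervalIntegral.integral_sub
    ((by fun_prop : Continuous fun s => g (s + ε)).intervalIntegrable _ _) (hi _ _),
    intervalIntegral.integral_comp_add_right, zero_add, ← mul_sub, one_div]
  have h2 := intervalIntegral.integral_add_adjacent_intervals (hi 0 t) (hi t (t + ε))
  have h3 := intervalIntegral.integral_add_adjacent_intervals (hi 0 ε) (hi ε (t + ε))
  congr 1
  linarith

theorem tendsto_exp_increment (c : ℝ) :
    Tendsto (fun ε : ℝ => (1 / ε) * (Real.exp (c * ε) - 1)) (𝓝[>] 0) (𝓝 c) := by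
  have h : HasDerivAt (fun ε : ℝ => Real.exp (c * ε)) c 0 := by
    simpa using ((hasDerivAt_id (0 : ℝ)).const_mul c).exp
  simpa using h.tendsto_slope_zero_right

/-- This is the finite-variation half of a product rule. Evaluating `z` at `s + ε` makes the
discrete product rule exact, with no cross term left over. -/
theorem tendsto_integral_mul_exp_increment {g z : ℝ → ℝ} (hg : Continuous g) (hz : Continuous z)
    (c t : ℝ) :
    Tendsto (fun ε : ℝ => (1 / ε) * ∫ s in (0 : ℝ)..t,
        g s * (Real.exp (c * (s + ε)) - Real.exp (c * s)) * z (s + ε)) (𝓝[>] 0)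
      (𝓝 (c * ∫ s in (0 : ℝ)..t, g s * Real.exp (c * s) * z s)) := by
  have h1 : Continuous fun ε : ℝ => ∫ s in (0 : ℝ)..t, g s * Real.exp (c * s) * z (s + ε) :=
    intervalIntegral.continuous_parametric_intervalIntegral_of_continuous' (by fun_prop) 0 t
  have h2 := (tendsto_exp_increment c).mul ((h1.tendsto 0).mono_left nhdsWithin_le_nhds)
  simp only [add_zero] at h2
  refine h2.congr fun ε => ?_
  rw [mul_assoc, ← intervalIntegral.integral_const_mul]
  congr 1
  refine intervalIntegral.integral_congr fun s _ => ?_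
  simp only [mul_add, Real.exp_add]
  ring

/-- The quadratic variation of `e^{cs} x_s`. -/
theorem tendsto_quadraticVariation_exp_mul {l : Filter ℝ} (hl : l ≤ 𝓝[>] 0) {x a : ℝ → ℝ}
    (hx : Continuous x) (c : ℝ) {t : ℝ} (ht : 0 ≤ t)
    (ha : IntervalIntegrable a volume 0 t) (ha0 : ∀ s, 0 ≤ a s)
    (hlim : ∀ u ∈ Icc 0 t, Tendsto (fun ε => (1 / ε) * ∫ s in (0 : ℝ)..u, (x (s + ε) - x s) ^ 2) l
      (𝓝 (∫ s in (0 : ℝ)..u, a s))) :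
    Tendsto (fun ε => (1 / ε) * ∫ s in (0 : ℝ)..t,
        (Real.exp (c * (s + ε)) * x (s + ε) - Real.exp (c * s) * x s) ^ 2) l
      (𝓝 (∫ s in (0 : ℝ)..t, Real.exp (c * s) ^ 2 * a s)) := by
  have hpos : ∀ᶠ ε in l, (0 : ℝ) < ε := hl self_mem_nhdsWithin
  have h1 : Tendsto (fun ε => ∫ s in (0 : ℝ)..t,
      Real.exp (c * s) ^ 2 * ((1 / ε) * (x (s + ε) - x s) ^ 2)) l
      (𝓝 (∫ s in (0 : ℝ)..t, Real.exp (c * s) ^ 2 * a s)) := by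
    refine tendsto_integral_mul_of_tendsto_primitive ht ?_ ha ha0 (by fun_prop) ?_
    · filter_upwards [hpos] with ε hε
      exact ⟨(by fun_prop : Continuous fun s => (1 / ε) * (x (s + ε) - x s) ^ 2).intervalIntegrable
        _ _, fun s => by positivity⟩
    · simpa only [intervalIntegral.integral_const_mul] using hlim
  -- With E = e^{cs} and primes for values at s + ε, (E'x' - Ex)² = E²(x' - x)² + (E'² - E²)x'² -
  -- 2Ex(E' - E)x'. The limits of the last two terms cancel.
  have h2 := (tendsto_integral_mul_exp_increment (g := fun _ => 1) (z := fun s => x s ^ 2)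
    (by fun_prop) (by fun_prop) (2 * c) t).mono_left hl
  have h3 := (tendsto_integral_mul_exp_increment (g := fun s => 2 * Real.exp (c * s) * x s)
    (by fun_prop) hx c t).mono_left hl
  have h4 := (h1.add h2).sub h3
  have e : (∫ s in (0 : ℝ)..t, Real.exp (c * s) ^ 2 * a s)
      + 2 * c * (∫ s in (0 : ℝ)..t, 1 * Real.exp (2 * c * s) * x s ^ 2)
      - c * (∫ s in (0 : ℝ)..t, 2 * Real.exp (c * s) * x s * Real.exp (c * s) * x s)
      = ∫ s in (0 : ℝ)..t, Real.exp (c * s) ^ 2 * a s := by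
    rw [add_sub_assoc, ← intervalIntegral.integral_const_mul, ← intervalIntegral.integral_const_mul,
      sub_eq_zero.2, add_zero]
    refine intervalIntegral.integral_congr fun s _ => ?_
    have : Real.exp (2 * c * s) = Real.exp (c * s) * Real.exp (c * s) := by
      rw [← Real.exp_add]; ring_nf
    simp only [this]
    ring
  rw [e] at h4
  refine h4.congr fun ε => ?_
  have hexp : ∀ u : ℝ, Real.exp (2 * c * u) = Real.exp (c * u) ^ 2 := fun u => by
    rw [← Real.exp_nat_mul]; push_cast; ring_nf
  have e2 : (∫ s in (0 : ℝ)..t, Real.exp (c * s) ^ 2 * ((1 / ε) * (x (s + ε) - x s) ^ 2))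
      = (1 / ε) * ∫ s in (0 : ℝ)..t, Real.exp (c * s) ^ 2 * (x (s + ε) - x s) ^ 2 := by
    rw [← intervalIntegral.integral_const_mul]
    exact intervalIntegral.integral_congr fun s _ => by ring
  rw [e2, ← mul_add, ← mul_sub, ← intervalIntegral.integral_add, ← intervalIntegral.integral_sub]
  · congr 1
    refine intervalIntegral.integral_congr fun s _ => ?_
    simp only [hexp]
    ring
  all_goals exact Continuous.intervalIntegrable (by fun_prop) _ _

/-! ### The pathwise Itô formula -/

/-- A second order Taylor estimate. -/
theorem abs_taylor_le {f f' f'' : ℝ → ℝ} {a b η : ℝ} (hη : 0 ≤ η)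
    (h1 : ∀ y, HasDerivAt f (f' y) y) (h2 : ∀ y, HasDerivAt f' (f'' y) y)
    (hb : ∀ y ∈ uIcc a b, |f'' y - f'' a| ≤ η) :
    |f b - f a - f' a * (b - a) - 1 / 2 * f'' a * (b - a) ^ 2| ≤ η * (b - a) ^ 2 := by
  -- The mean value inequality is used twice, first for the derivative and then for the function;
  -- the lost factor 1/2 is harmless.
  have hfirst : ∀ y ∈ uIcc a b, |f' y - f' a - f'' a * (y - a)| ≤ η * |b - a| := by
    intro y hy
    have := (convex_uIcc a b).norm_image_sub_le_of_norm_hasDerivWithin_le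
      (f := fun y => f' y - f'' a * y) (f' := fun y => f'' y - f'' a) (C := η)
      (fun u _ => by
        simpa using ((h2 u).fun_sub ((hasDerivAt_id u).const_mul (f'' a))).hasDerivWithinAt)
      hb left_mem_uIcc hy
    rw [Real.norm_eq_abs, Real.norm_eq_abs] at this
    calc |f' y - f' a - f'' a * (y - a)| = |f' y - f'' a * y - (f' a - f'' a * a)| := by ring_nf
      _ ≤ η * |y - a| := this
      _ ≤ η * |b - a| := mul_le_mul_of_nonneg_left (abs_sub_left_of_mem_uIcc hy) hη
  have := (convex_uIcc a b).norm_image_sub_le_of_norm_hasDerivWithin_le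
    (f := fun y => f y - f' a * y - 1 / 2 * f'' a * (y - a) ^ 2)
    (f' := fun y => f' y - f' a - f'' a * (y - a)) (C := η * |b - a|)
    (fun u _ => by
      have h3 : HasDerivAt (fun y => 1 / 2 * f'' a * (y - a) ^ 2) (f'' a * (u - a)) u := by
        convert! (((hasDerivAt_id u).sub_const a).pow 2).const_mul (1 / 2 * f'' a) using 1
        simp
        ring
      simpa using (((h1 u).fun_sub ((hasDerivAt_id u).const_mul (f' a))).fun_sub h3).hasDerivWithinAt)
    hfirst left_mem_uIcc right_mem_uIcc
  rw [Real.norm_eq_abs, Real.norm_eq_abs, mul_assoc η, ← pow_two, sq_abs] at this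
  calc _ = |f b - f' a * b - 1 / 2 * f'' a * (b - a) ^ 2
        - (f a - f' a * a - 1 / 2 * f'' a * (a - a) ^ 2)| := by ring_nf
    _ ≤ _ := this

/-- Uniform smallness, on a compact set, of a continuous function that vanishes at parameter `0`. -/
theorem eventually_forall_abs_le {β : Type*} [TopologicalSpace β] {K : Set β} (hK : IsCompact K)
    {G : ℝ → β → ℝ} (hG : Continuous (Function.uncurry G)) (h0 : ∀ y, G 0 y = 0)
    {η : ℝ} (hη : 0 < η) : ∀ᶠ ε in 𝓝[>] (0 : ℝ), ∀ y ∈ K, |G ε y| ≤ η := by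
  refine nhdsWithin_le_nhds (hK.eventually_forall_of_forall_eventually fun y _ => ?_)
  have : Tendsto (fun z : ℝ × β => |G z.1 z.2|) (𝓝 (0, y)) (𝓝 |G 0 y|) :=
    (hG.abs).tendsto (0, y)
  rw [h0, abs_zero] at this
  exact (this.eventually (gt_mem_nhds hη)).mono fun _ h => le_of_lt h

/-- The Itô formula along a path with given quadratic variation. -/
theorem tendsto_forward_ito {l : Filter ℝ} (hl : l ≤ 𝓝[>] 0) {x a : ℝ → ℝ}
    (hx : Continuous x) {t T : ℝ} (ht : 0 ≤ t) (htT : t < T)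
    (ha : IntervalIntegrable a volume 0 t) (ha0 : ∀ s, 0 ≤ a s)
    (hlim : ∀ u ∈ Icc 0 t, Tendsto (fun ε => (1 / ε) * ∫ s in (0 : ℝ)..u, (x (s + ε) - x s) ^ 2) l
      (𝓝 (∫ s in (0 : ℝ)..u, a s)))
    {F Ft Fy Fyy : ℝ → ℝ → ℝ} (hF : Continuous fun p : ℝ × ℝ => F p.1 p.2)
    (hFt : Continuous fun p : ℝ × ℝ => Ft p.1 p.2) (hFy : Continuous fun p : ℝ × ℝ => Fy p.1 p.2)
    (hFyy : Continuous fun p : ℝ × ℝ => Fyy p.1 p.2)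
    (dFt : ∀ s ∈ Ioo 0 T, ∀ y, HasDerivAt (fun s => F s y) (Ft s y) s)
    (dFy : ∀ s y, HasDerivAt (F s) (Fy s y) y) (dFyy : ∀ s y, HasDerivAt (Fy s) (Fyy s y) y) :
    Tendsto (fun ε => (1 / ε) * ∫ s in (0 : ℝ)..t, Fy s (x s) * (x (s + ε) - x s)) l
      (𝓝 (F t (x t) - F 0 (x 0) - (∫ s in (0 : ℝ)..t, Ft s (x s))
        - 1 / 2 * ∫ s in (0 : ℝ)..t, Fyy s (x s) * a s)) := by
  have cF : ∀ {u w : ℝ → ℝ}, Continuous u → Continuous w → Continuous fun s => F (u s) (w s) :=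
    fun hu hw => hF.comp (hu.prodMk hw)
  have cFy : Continuous fun s => Fy s (x s) := hFy.comp (continuous_id.prodMk hx)
  have cFt : Continuous fun s => Ft s (x s) := hFt.comp (continuous_id.prodMk hx)
  have cFyy : Continuous fun s => Fyy s (x s) := hFyy.comp (continuous_id.prodMk hx)
  have hpos : ∀ᶠ ε in 𝓝[>] (0 : ℝ), (0 : ℝ) < ε := self_mem_nhdsWithin
  have hsmall : ∀ᶠ ε in 𝓝[>] (0 : ℝ), ε < T - t :=
    nhdsWithin_le_nhds (gt_mem_nhds (sub_pos.2 htT))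
  -- the total increment
  have h1 := (tendsto_average_increment (cF continuous_id hx) t).mono_left hl
  -- the increment in time
  have h2 : Tendsto (fun ε => ∫ s in (0 : ℝ)..t,
      (1 / ε) * (F (s + ε) (x (s + ε)) - F s (x (s + ε)))) (𝓝[>] 0)
      (𝓝 (∫ s in (0 : ℝ)..t, Ft s (x s))) := by
    refine TendstoUniformlyOn.tendsto_intervalIntegral_of_continuousOn
      (Eventually.of_forall fun ε => Continuous.continuousOn ?_) ?_
    · exact continuous_const.mul ((cF (by fun_prop) (by fun_prop)).sub
        (cF (by fun_prop) (by fun_prop)))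
    rw [Metric.tendstoUniformlyOn_iff]
    intro η hη
    -- The extra variable in [0,1] locates the intermediate point s + θε of the mean value theorem,
    -- so compactness gives an estimate uniform in both s and θ.
    have := eventually_forall_abs_le (K := Icc (0 : ℝ) t ×ˢ Icc (0 : ℝ) 1)
      (isCompact_Icc.prod isCompact_Icc)
      (G := fun ε p => Ft (p.1 + p.2 * ε) (x (p.1 + ε)) - Ft p.1 (x p.1))
      ((hFt.comp (Continuous.prodMk (by fun_prop) (by fun_prop))).sub
        (cFt.comp (by fun_prop))) (fun p => by simp) (half_pos hη)
    filter_upwards [this, hpos, hsmall] with ε h hε hεT s hs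
    rw [uIcc_of_le ht] at hs
    obtain ⟨c, hc, hc'⟩ := exists_hasDerivAt_eq_slope (fun u => F u (x (s + ε)))
      (fun u => Ft u (x (s + ε))) (by linarith : s < s + ε)
      (cF continuous_id continuous_const).continuousOn
      (fun u hu => dFt u ⟨hs.1.trans_lt hu.1, by linarith [hu.2, hs.2]⟩ _)
    have hθ := h (s, (c - s) / ε) ⟨hs, div_nonneg (by linarith [hc.1]) hε.le, by
      rw [div_le_one hε]; linarith [hc.2]⟩
    simp only [div_mul_cancel₀ _ hε.ne', add_sub_cancel] at hθ
    rw [hc', add_sub_cancel_left] at hθ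
    rw [dist_comm, Real.dist_eq, one_div_mul_eq_div]
    linarith
  -- the quadratic term
  have h3 : Tendsto (fun ε => ∫ s in (0 : ℝ)..t,
      Fyy s (x s) * ((1 / ε) * (x (s + ε) - x s) ^ 2)) l
      (𝓝 (∫ s in (0 : ℝ)..t, Fyy s (x s) * a s)) := by
    refine tendsto_integral_mul_of_tendsto_primitive ht ?_ ha ha0 cFyy ?_
    · filter_upwards [hl hpos] with ε hε
      exact ⟨(by fun_prop : Continuous fun s => (1 / ε) * (x (s + ε) - x s) ^ 2).intervalIntegrable
        _ _, fun s => by positivity⟩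
    · simpa only [intervalIntegral.integral_const_mul] using hlim
  -- the remainder
  set R : ℝ → ℝ → ℝ := fun ε s => F s (x (s + ε)) - F s (x s) - Fy s (x s) * (x (s + ε) - x s)
    - 1 / 2 * Fyy s (x s) * (x (s + ε) - x s) ^ 2 with hR
  have cR : ∀ ε, Continuous (R ε) := fun ε => by
    have h5 := cF (u := fun s => s) (w := fun s => x (s + ε)) (by fun_prop) (by fun_prop)
    have h6 := cF (u := fun s => s) (w := fun s => x s) (by fun_prop) (by fun_prop)
    simp only [hR]
    fun_prop
  have h4 : Tendsto (fun ε => (1 / ε) * ∫ s in (0 : ℝ)..t, R ε s) l (𝓝 0) := by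
    rw [Metric.tendsto_nhds]
    intro δ hδ
    set A := ∫ s in (0 : ℝ)..t, a s
    have hA : 0 ≤ A := intervalIntegral.integral_nonneg ht fun s _ => ha0 s
    -- The regularized quadratic variation is eventually below A + 1, so this Taylor constant yields
    -- a remainder of at most δ/2.
    have hη : 0 < δ / (2 * (A + 1)) := by positivity
    have := eventually_forall_abs_le (K := Icc (0 : ℝ) t ×ˢ Icc (0 : ℝ) 1)
      (isCompact_Icc.prod isCompact_Icc)
      (G := fun ε p => Fyy p.1 (x p.1 + p.2 * (x (p.1 + ε) - x p.1)) - Fyy p.1 (x p.1))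
      (show Continuous fun q : ℝ × ℝ × ℝ => Fyy q.2.1 (x q.2.1 + q.2.2 * (x (q.2.1 + q.1) - x q.2.1))
        - Fyy q.2.1 (x q.2.1) from
        (hFyy.comp ((by fun_prop : Continuous fun q : ℝ × ℝ × ℝ => q.2.1).prodMk
          (by fun_prop : Continuous fun q : ℝ × ℝ × ℝ =>
            x q.2.1 + q.2.2 * (x (q.2.1 + q.1) - x q.2.1)))).sub (cFyy.comp (by fun_prop))) (fun p => by simp) hη
    filter_upwards [hl this, hl hpos, (hlim t ⟨ht, le_rfl⟩).eventually (gt_mem_nhds (lt_add_one A))]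
      with ε h hε hQ
    have hRs : ∀ s ∈ Icc 0 t, |R ε s| ≤ δ / (2 * (A + 1)) * (x (s + ε) - x s) ^ 2 := by
      intro s hs
      refine abs_taylor_le hη.le (dFy s) (dFyy s) fun y hy => ?_
      rw [← segment_eq_uIcc, segment_eq_image'] at hy
      obtain ⟨θ, hθ, rfl⟩ := hy
      simpa using h (s, θ) ⟨hs, hθ⟩
    have hint : |∫ s in (0 : ℝ)..t, R ε s|
        ≤ δ / (2 * (A + 1)) * ∫ s in (0 : ℝ)..t, (x (s + ε) - x s) ^ 2 := by
      rw [← intervalIntegral.integral_const_mul, ← Real.norm_eq_abs]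
      exact intervalIntegral.norm_integral_le_of_norm_le ht
        (ae_of_all _ fun s hs => hRs s (Ioc_subset_Icc_self hs))
        (Continuous.intervalIntegrable (by fun_prop) _ _)
    rw [Real.dist_eq, sub_zero, abs_mul, abs_of_pos (one_div_pos.2 hε)]
    calc 1 / ε * |∫ s in (0 : ℝ)..t, R ε s|
        ≤ 1 / ε * (δ / (2 * (A + 1)) * ∫ s in (0 : ℝ)..t, (x (s + ε) - x s) ^ 2) := by gcongr
      _ = δ / (2 * (A + 1)) * (1 / ε * ∫ s in (0 : ℝ)..t, (x (s + ε) - x s) ^ 2) := by ring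
      _ ≤ δ / (2 * (A + 1)) * (A + 1) := by gcongr
      _ = δ / 2 := by field_simp
      _ < δ := half_lt_self hδ
  have h5 := ((h1.sub (h2.mono_left hl)).sub (h3.const_mul (1 / 2))).sub h4
  rw [sub_zero] at h5
  refine h5.congr fun ε => ?_
  have c1 := cF (u := fun s => s) (w := fun s => x (s + ε)) (by fun_prop) (by fun_prop)
  have c2 := cF (u := fun s => s) (w := fun s => x s) (by fun_prop) (by fun_prop)
  have c3 := cF (u := fun s => s + ε) (w := fun s => x (s + ε)) (by fun_prop) (by fun_prop)
  have cR' := cR ε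
  rw [← intervalIntegral.integral_const_mul, ← intervalIntegral.integral_const_mul,
    ← intervalIntegral.integral_const_mul, ← intervalIntegral.integral_const_mul,
    ← intervalIntegral.integral_sub, ← intervalIntegral.integral_sub,
    ← intervalIntegral.integral_sub]
  · refine intervalIntegral.integral_congr fun s _ => ?_
    simp only [hR, id]
    ring
  all_goals exact Continuous.intervalIntegrable (by fun_prop) _ _

/-! ### Clamping in time and the backward equation -/

/-- The retraction of the line onto `[0,T]`. -/
noncomputable def clamp (T s : ℝ) : ℝ := max 0 (min s T)

@[fun_prop]
theorem continuous_clamp (T : ℝ) : Continuous (clamp T) := by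
  unfold clamp
  fun_prop

theorem clamp_mem {T : ℝ} (hT : 0 ≤ T) (s : ℝ) : clamp T s ∈ Icc 0 T :=
  ⟨le_max_left _ _, max_le hT (min_le_right _ _)⟩

theorem clamp_of_mem {T s : ℝ} (hs : s ∈ Icc 0 T) : clamp T s = s := by
  rw [clamp, min_eq_left hs.2, max_eq_right hs.1]

theorem clamp_of_nonneg {T s : ℝ} (hT : 0 ≤ T) (hs : 0 ≤ s) : clamp T s = min s T :=
  max_eq_right (le_min hs hT)

theorem _root_.ContinuousOn.comp_clamp {f : ℝ → ℝ} {T : ℝ} (hf : ContinuousOn f (Icc 0 T))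
    (hT : 0 ≤ T) : Continuous fun s => f (clamp T s) :=
  hf.comp_continuous (continuous_clamp T) (clamp_mem hT)

/-- Itô's formula for `e^{ct} v(t, x_t)`, for a path `x` along which `v` solves the
backward equation. -/
theorem IsC12.tendsto_forward {v : ℝ → ℝ → ℝ} (hv : IsC12 v) {l : Filter ℝ} (hl : l ≤ 𝓝[>] 0)
    {x a : ℝ → ℝ} (hx : Continuous x) {t : ℝ} (ht : t ∈ Ico (0 : ℝ) 1)
    (ha : IntervalIntegrable a volume 0 t) (ha0 : ∀ s, 0 ≤ a s)
    (hlim : ∀ u ∈ Icc 0 t, Tendsto (fun ε => (1 / ε) * ∫ s in (0 : ℝ)..u, (x (s + ε) - x s) ^ 2) l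
      (𝓝 (∫ s in (0 : ℝ)..u, a s)))
    (hpde : ∀ s ∈ Icc 0 t, dt v s (x s) + 1 / 2 * a s * dyy v s (x s) = 0) (c : ℝ) :
    Tendsto (fun ε => (1 / ε) * ∫ s in (0 : ℝ)..t,
        Real.exp (c * s) * dy v s (x s) * (x (s + ε) - x s)) l
      (𝓝 (Real.exp (c * t) * v t (x t) - v 0 (x 0)
        - c * ∫ s in (0 : ℝ)..t, Real.exp (c * s) * v s (x s))) := by
  -- Freezing time beyond T < 1 makes v and its derivatives continuous on the whole plane. As t < T,
  -- the increments over [s, s + ε] with s ≤ t stay, for small ε, where nothing has been changed.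
  obtain ⟨T, htT, hT1⟩ := exists_between ht.2
  have hT0 : 0 ≤ T := ht.1.trans htT.le
  have hmem : ∀ s, clamp T s ∈ Ico (0 : ℝ) 1 := fun s =>
    ⟨(clamp_mem hT0 s).1, (clamp_mem hT0 s).2.trans_lt hT1⟩
  have hcl : ∀ s ∈ Icc 0 t, clamp T s = s := fun s hs => clamp_of_mem ⟨hs.1, hs.2.trans htT.le⟩
  have hcont : ∀ {f : ℝ → ℝ → ℝ}, ContinuousOn (fun p : ℝ × ℝ => f p.1 p.2) (Ico 0 1 ×ˢ univ) →
      Continuous fun p : ℝ × ℝ => f (clamp T p.1) p.2 := fun hf =>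
    hf.comp_continuous (f := fun p : ℝ × ℝ => (clamp T p.1, p.2)) (by fun_prop)
      fun p => ⟨hmem p.1, mem_univ _⟩
  have cv := hcont hv.continuousOn
  have cdt := hcont hv.continuousOn_dt
  have cdy := hcont hv.continuousOn_dy
  have cdyy := hcont hv.continuousOn_dyy
  have cx : Continuous fun s : ℝ => (s, x s) := by fun_prop
  have cE : Continuous fun p : ℝ × ℝ => Real.exp (c * p.1) := by fun_prop
  have main := tendsto_forward_ito hl hx ht.1 htT ha ha0 hlim
    (F := fun s y => Real.exp (c * s) * v (clamp T s) y)
    (Ft := fun s y => Real.exp (c * s) * (c * v (clamp T s) y + dt v (clamp T s) y))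
    (Fy := fun s y => Real.exp (c * s) * dy v (clamp T s) y)
    (Fyy := fun s y => Real.exp (c * s) * dyy v (clamp T s) y)
    (cE.mul cv) (cE.mul ((cv.const_mul c).add cdt)) (cE.mul cdy) (cE.mul cdyy)
    (fun s hs y => by
      have h1 : HasDerivAt (fun u => v u y) (dt v s y) s :=
        ((hv.differentiable_t y s ⟨hs.1.le, hs.2.trans hT1⟩).hasDerivWithinAt).hasDerivAt
          (Ico_mem_nhds hs.1 (hs.2.trans hT1))
      have h2 : HasDerivAt (fun u => v (clamp T u) y) (dt v s y) s :=
        h1.congr_of_eventuallyEq (by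
          filter_upwards [Icc_mem_nhds hs.1 hs.2] with u hu
          rw [clamp_of_mem hu])
      have h3 : HasDerivAt (fun u : ℝ => Real.exp (c * u)) (Real.exp (c * s) * c) s := by
        simpa using ((hasDerivAt_id s).const_mul c).exp
      convert! h3.fun_mul h2 using 1
      rw [clamp_of_mem ⟨hs.1.le, hs.2.le⟩]
      ring)
    (fun s y => ((hv.differentiable_y _ (hmem s)) y).hasDerivAt.const_mul _)
    (fun s y => ((hv.differentiable_yy _ (hmem s)) y).hasDerivAt.const_mul _)
  have e1 : ∀ ε, (∫ s in (0 : ℝ)..t, Real.exp (c * s) * dy v (clamp T s) (x s)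
      * (x (s + ε) - x s)) = ∫ s in (0 : ℝ)..t, Real.exp (c * s) * dy v s (x s)
      * (x (s + ε) - x s) := fun ε => intervalIntegral.integral_congr fun s hs => by
    rw [uIcc_of_le ht.1] at hs
    simp only [hcl s hs]
  simp only [e1] at main
  convert! main using 2
  have i1 : IntervalIntegrable (fun s => Real.exp (c * s) * dyy v (clamp T s) (x s) * a s)
      volume 0 t := ha.continuousOn_mul
    ((by fun_prop : Continuous fun s : ℝ => Real.exp (c * s)).mul (cdyy.comp cx)).continuousOn
  have i2 : IntervalIntegrable
      (fun s => Real.exp (c * s) * (c * v (clamp T s) (x s) + dt v (clamp T s) (x s)))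
      volume 0 t := ((by fun_prop : Continuous fun s : ℝ => Real.exp (c * s)).mul
    (((cv.comp cx).const_mul c).add (cdt.comp cx))).intervalIntegrable _ _
  rw [hcl t ⟨ht.1, le_rfl⟩, hcl 0 ⟨le_rfl, ht.1⟩, mul_zero, Real.exp_zero, one_mul, sub_sub,
    sub_sub, sub_sub, ← intervalIntegral.integral_const_mul, ← intervalIntegral.integral_const_mul,
    ← intervalIntegral.integral_add i2 (i1.const_mul _)]
  congr 2
  refine intervalIntegral.integral_congr fun s hs => ?_
  rw [uIcc_of_le ht.1] at hs
  simp only [hcl s hs]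
  linear_combination (-Real.exp (c * s)) * hpde s hs

/-! ### Forward integrals along a single path -/

section Paths

variable {Ω : Type*}

/-- The backward equation is adapted to S̃, so Itô's formula is applied to S̃ only. Exponent c = 0
gives the integral against S̃; c = r gives that of e^{rs} h, and the product rule for S = e^{rs} S̃
adds the term r ∫ h S. -/
theorem tendsto_forwardApprox_of_path {l : Filter ℝ} (hl : l ≤ 𝓝[>] 0) {S : ℝ → Ω → ℝ} {ω : Ω}
    (hS : ContinuousOn (fun t => S t ω) (Icc 0 1)) {a : ℝ → ℝ}
    (ha : IntervalIntegrable a volume 0 1) (ha0 : ∀ s, 0 ≤ a s)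
    (hqv : ∀ u ∈ Icc (0 : ℝ) 1, Tendsto (fun ε => covariationApprox 1 ε S S u ω) l
      (𝓝 (∫ s in (0 : ℝ)..u, a s)))
    {v : ℝ → ℝ → ℝ} (hv : IsC12 v) {r : ℝ}
    (hpde : ∀ s ∈ Ico (0 : ℝ) 1, dt v s (discounted r S s ω)
      + 1 / 2 * (Real.exp (-r * s) ^ 2 * a s) * dyy v s (discounted r S s ω) = 0)
    {h : ℝ → Ω → ℝ} (hh : ∀ t ∈ Ico (0 : ℝ) 1, h t ω = dy v t (discounted r S t ω))
    {t : ℝ} (ht : t ∈ Ico (0 : ℝ) 1) :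
    Tendsto (fun ε => forwardApprox 1 ε h (discounted r S) t ω) l
      (𝓝 (v t (discounted r S t ω) - v 0 (S 0 ω))) ∧
    Tendsto (fun ε => forwardApprox 1 ε h S t ω) l
      (𝓝 (Real.exp (r * t) * v t (discounted r S t ω) - v 0 (S 0 ω)
        - r * (∫ s in (0 : ℝ)..t, Real.exp (r * s) * v s (discounted r S s ω))
        + r * ∫ s in (0 : ℝ)..t, h s ω * S s ω)) := by
  set y : ℝ → ℝ := fun s => S (clamp 1 s) ω with hy
  have cy : Continuous y := hS.comp_clamp zero_le_one
  set x : ℝ → ℝ := fun s => Real.exp (-r * s) * y s with hxdef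
  have cx : Continuous x := by fun_prop
  have hmin : ∀ s, 0 ≤ s → S (min s 1) ω = y s := fun s hs => by
    simp only [hy, clamp_of_nonneg zero_le_one hs]
  have hy1 : ∀ s ∈ Icc (0 : ℝ) 1, S s ω = y s := fun s hs => by simp only [hy, clamp_of_mem hs]
  have hx1 : ∀ s ∈ Icc (0 : ℝ) 1, discounted r S s ω = x s := fun s hs => by
    simp only [discounted, hxdef, hy1 s hs, neg_mul]
  have hsub : ∀ {s}, s ∈ Icc 0 t → s ∈ Icc (0 : ℝ) 1 := fun hs => ⟨hs.1, hs.2.trans ht.2.le⟩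
  have hx0 : x 0 = S 0 ω := by simp [hxdef, hy1 0 (by simp)]
  have hpos : ∀ᶠ ε in l, (0 : ℝ) < ε := hl self_mem_nhdsWithin
  have hsmall : ∀ᶠ ε in l, ε < 1 - t :=
    hl (nhdsWithin_le_nhds (gt_mem_nhds (sub_pos.2 ht.2)))
  have qv : ∀ u ∈ Icc 0 t, Tendsto (fun ε => (1 / ε) * ∫ s in (0 : ℝ)..u, (y (s + ε) - y s) ^ 2) l
      (𝓝 (∫ s in (0 : ℝ)..u, a s)) := fun u hu => by
    refine (hqv u (hsub hu)).congr' ?_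
    filter_upwards [hpos] with ε hε
    rw [covariationApprox]
    congr 1
    refine intervalIntegral.integral_congr fun s hs => ?_
    rw [uIcc_of_le hu.1] at hs
    simp only [hmin s hs.1, hmin (s + ε) (by linarith [hs.1]), pow_two]
  have hat : ∀ u ∈ Icc 0 t, IntervalIntegrable a volume 0 u := fun u hu => ha.mono_set (by
    rw [uIcc_of_le hu.1, uIcc_of_le zero_le_one]
    exact Icc_subset_Icc le_rfl (hsub hu).2)
  have qvx : ∀ u ∈ Icc 0 t, Tendsto (fun ε => (1 / ε) * ∫ s in (0 : ℝ)..u, (x (s + ε) - x s) ^ 2) l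
      (𝓝 (∫ s in (0 : ℝ)..u, Real.exp (-r * s) ^ 2 * a s)) := fun u hu =>
    tendsto_quadraticVariation_exp_mul hl cy (-r) hu.1 (hat u hu) ha0
      fun w hw => qv w ⟨hw.1, hw.2.trans hu.2⟩
  have ito := hv.tendsto_forward hl cx ht
    ((hat t ⟨ht.1, le_rfl⟩).continuousOn_mul (by fun_prop)) (fun s => by have := ha0 s; positivity)
    qvx (fun s hs => by rw [← hx1 s (hsub hs)]; exact hpde s ⟨hs.1, hs.2.trans_lt ht.2⟩)
  have hhx : ∀ s ∈ Icc 0 t, h s ω = dy v s (x s) := fun s hs => by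
    rw [hh s ⟨hs.1, hs.2.trans_lt ht.2⟩, hx1 s (hsub hs)]
  rw [hx1 t (hsub ⟨ht.1, le_rfl⟩), ← hx0]
  refine ⟨?_, ?_⟩
  · have h0 := ito 0
    simp only [zero_mul, Real.exp_zero, one_mul, sub_zero] at h0
    refine h0.congr' ?_
    filter_upwards [hpos, hsmall] with ε hε hε1
    rw [forwardApprox]
    congr 1
    refine intervalIntegral.integral_congr fun s hs => ?_
    rw [uIcc_of_le ht.1] at hs
    rw [min_eq_left (by linarith [hs.2] : s + ε ≤ 1), min_eq_left (hsub hs).2, hhx s hs,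
      hx1 s (hsub hs), hx1 (s + ε) ⟨by linarith [hs.1], by linarith [hs.2]⟩]
  -- Clamping at t extends the integrand continuously to the line without changing it on [0,t].
  · set g : ℝ → ℝ := fun s => dy v (clamp t s) (x (clamp t s)) with hg
    have cg : Continuous g := hv.continuousOn_dy.comp_continuous
      (f := fun s => (clamp t s, x (clamp t s))) (by fun_prop) fun s =>
        ⟨⟨(clamp_mem ht.1 s).1, (clamp_mem ht.1 s).2.trans_lt ht.2⟩, mem_univ _⟩
    have hgx : ∀ s ∈ Icc 0 t, dy v s (x s) = g s := fun s hs => by simp only [hg, clamp_of_mem hs]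
    have hey : ∀ s, Real.exp (r * s) * x s = y s := fun s => by
      simp only [hxdef]
      rw [← mul_assoc, ← Real.exp_add]
      simp
    have h1 := (ito r).add ((tendsto_integral_mul_exp_increment cg cx r t).mono_left hl)
    have e1 : ∫ s in (0 : ℝ)..t, Real.exp (r * s) * v s (discounted r S s ω)
        = ∫ s in (0 : ℝ)..t, Real.exp (r * s) * v s (x s) :=
      intervalIntegral.integral_congr fun s hs => by
        rw [uIcc_of_le ht.1] at hs
        simp only [hx1 s (hsub hs)]
    have e2 : ∫ s in (0 : ℝ)..t, h s ω * S s ω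
        = ∫ s in (0 : ℝ)..t, g s * Real.exp (r * s) * x s :=
      intervalIntegral.integral_congr fun s hs => by
        rw [uIcc_of_le ht.1] at hs
        simp only [hhx s hs, hgx s hs, hy1 s (hsub hs), mul_assoc, hey]
    rw [e1, e2]
    refine h1.congr' ?_
    filter_upwards [hpos] with ε hε
    rw [forwardApprox, ← mul_add]
    congr 1
    have e3 : ∫ s in (0 : ℝ)..t, Real.exp (r * s) * dy v s (x s) * (x (s + ε) - x s)
        = ∫ s in (0 : ℝ)..t, Real.exp (r * s) * g s * (x (s + ε) - x s) :=
      intervalIntegral.integral_congr fun s hs => by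
        rw [uIcc_of_le ht.1] at hs
        simp only [hgx s hs]
    rw [e3, ← intervalIntegral.integral_add (Continuous.intervalIntegrable (by fun_prop) _ _)
      (Continuous.intervalIntegrable (by fun_prop) _ _)]
    refine intervalIntegral.integral_congr fun s hs => ?_
    rw [uIcc_of_le ht.1] at hs
    simp only [hmin s hs.1, hmin (s + ε) (by linarith [hs.1]), hhx s hs, hgx s hs, ← hey]
    ring

/-- Pathwise integration by parts for a smooth deterministic integrand. -/
theorem tendsto_forwardApprox_exp {T c t : ℝ} (ht : t ∈ Icc 0 T) {Z : ℝ → Ω → ℝ} {ω : Ω}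
    (hZ : ContinuousOn (fun t => Z t ω) (Icc 0 T)) :
    Tendsto (fun ε => forwardApprox T ε (fun s _ => Real.exp (c * s)) Z t ω) (𝓝[>] 0)
      (𝓝 (Real.exp (c * t) * Z t ω - Z 0 ω - c * ∫ s in (0 : ℝ)..t, Real.exp (c * s) * Z s ω)) := by
  have hT : 0 ≤ T := ht.1.trans ht.2
  set z : ℝ → ℝ := fun s => Z (clamp T s) ω with hz
  have cz : Continuous z := hZ.comp_clamp hT
  have hmin : ∀ s, 0 ≤ s → Z (min s T) ω = z s := fun s hs => by
    simp only [hz, clamp_of_nonneg hT hs]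
  have hz1 : ∀ s ∈ Icc 0 t, Z s ω = z s := fun s hs => by
    simp only [hz, clamp_of_mem ⟨hs.1, hs.2.trans ht.2⟩]
  have h1 := (tendsto_average_increment (g := fun s => Real.exp (c * s) * z s) (by fun_prop) t).sub
    (tendsto_integral_mul_exp_increment (g := fun _ => 1) (by fun_prop) cz c t)
  simp only [mul_zero, Real.exp_zero, one_mul] at h1
  have e : ∫ s in (0 : ℝ)..t, Real.exp (c * s) * Z s ω
      = ∫ s in (0 : ℝ)..t, Real.exp (c * s) * z s :=
    intervalIntegral.integral_congr fun s hs => by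
      rw [uIcc_of_le ht.1] at hs
      simp only [hz1 s hs]
  rw [e, hz1 t ⟨ht.1, le_rfl⟩, hz1 0 ⟨le_rfl, ht.1⟩]
  refine h1.congr' ?_
  filter_upwards [self_mem_nhdsWithin] with ε hε
  rw [forwardApprox, ← mul_sub, ← intervalIntegral.integral_sub
    (Continuous.intervalIntegrable (by fun_prop) _ _)
    (Continuous.intervalIntegrable (by fun_prop) _ _)]
  congr 1
  refine intervalIntegral.integral_congr fun s hs => ?_
  rw [uIcc_of_le ht.1] at hs
  simp only [hmin s hs.1, hmin (s + ε) (add_nonneg hs.1 (le_of_lt hε))]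
  ring

end Paths

/-- Integration by parts. The left side has the shape in which `tendsto_forwardApprox_exp` delivers
the integral of e^{cs} against a primitive. -/
theorem integral_exp_mul_primitive {k : ℝ → ℝ} {t : ℝ} (ht : 0 ≤ t) (hk : ContinuousOn k (Icc 0 t))
    (c : ℝ) :
    Real.exp (c * t) * (∫ s in (0 : ℝ)..t, k s)
        - c * ∫ s in (0 : ℝ)..t, Real.exp (c * s) * ∫ u in (0 : ℝ)..s, k u
      = ∫ s in (0 : ℝ)..t, Real.exp (c * s) * k s := by
  set κ : ℝ → ℝ := fun s => k (clamp t s) with hκ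
  have cκ : Continuous κ := hk.comp_clamp ht
  have hkκ : ∀ s ∈ Icc 0 t, k s = κ s := fun s hs => by simp only [hκ, clamp_of_mem hs]
  have e0 : ∀ s ∈ Icc 0 t, ∫ u in (0 : ℝ)..s, k u = ∫ u in (0 : ℝ)..s, κ u := fun s hs =>
    intervalIntegral.integral_congr fun u hu => by
      rw [uIcc_of_le hs.1] at hu
      exact hkκ u ⟨hu.1, hu.2.trans hs.2⟩
  have e1 : (∫ s in (0 : ℝ)..t, Real.exp (c * s) * ∫ u in (0 : ℝ)..s, k u)
      = ∫ s in (0 : ℝ)..t, Real.exp (c * s) * ∫ u in (0 : ℝ)..s, κ u :=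
    intervalIntegral.integral_congr fun s hs => by
      rw [uIcc_of_le ht] at hs
      simp only [e0 s hs]
  have e2 : (∫ s in (0 : ℝ)..t, Real.exp (c * s) * k s)
      = ∫ s in (0 : ℝ)..t, Real.exp (c * s) * κ s :=
    intervalIntegral.integral_congr fun s hs => by
      rw [uIcc_of_le ht] at hs
      simp only [hkκ s hs]
  rw [e1, e2, e0 t ⟨ht, le_rfl⟩]
  have := intervalIntegral.integral_mul_deriv_eq_deriv_mul (a := 0) (b := t)
    (u := fun s => Real.exp (c * s)) (u' := fun s => Real.exp (c * s) * c)
    (v := fun s => ∫ u in (0 : ℝ)..s, κ u) (v' := κ)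
    (fun s _ => by simpa using ((hasDerivAt_id s).const_mul c).exp)
    (fun s _ => intervalIntegral.integral_hasDerivAt_right (cκ.intervalIntegrable _ _)
      (cκ.stronglyMeasurableAtFilter _ _) cκ.continuousAt)
    (Continuous.intervalIntegrable (by fun_prop) _ _) (cκ.intervalIntegrable _ _)
  rw [this, intervalIntegral.integral_same, mul_zero, sub_zero,
    ← intervalIntegral.integral_const_mul c]
  congr 1
  exact intervalIntegral.integral_congr fun s _ => by ring

/-! ### Almost sure limits along subsequences and convergence in probability -/

section Measurability

variable {Ω : Type*} {mΩ : MeasurableSpace Ω}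

/-- After clamping, the integrand is continuous in s and measurable in ω, hence jointly measurable.
-/
theorem measurable_integral_of_continuousOn {t : ℝ} (ht : 0 ≤ t) {φ : ℝ → Ω → ℝ}
    (hc : ∀ ω, ContinuousOn (fun s => φ s ω) (Icc 0 t)) (hm : ∀ s ∈ Icc 0 t, Measurable (φ s)) :
    Measurable fun ω => ∫ s in (0 : ℝ)..t, φ s ω := by
  have h1 : StronglyMeasurable (Function.uncurry fun s ω => φ (clamp t s) ω) :=
    stronglyMeasurable_uncurry_of_continuous_of_stronglyMeasurable
      (fun ω => (hc ω).comp_clamp ht) fun s => (hm _ (clamp_mem ht s)).stronglyMeasurable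
  have h2 : Measurable fun ω => ∫ s in (0 : ℝ)..t, φ (clamp t s) ω := by
    simp only [intervalIntegral.integral_of_le ht]
    exact h1.integral_prod_left.measurable
  convert! h2 using 2 with ω
  refine intervalIntegral.integral_congr fun s hs => ?_
  rw [uIcc_of_le ht] at hs
  simp only [clamp_of_mem hs]

theorem measurable_forwardApprox {T ε t : ℝ} (ht : t ∈ Icc 0 T) (hε : 0 < ε) {Y X : ℝ → Ω → ℝ}
    (hY : ∀ ω, ContinuousOn (fun s => Y s ω) (Icc 0 t)) (hYm : ∀ s ∈ Icc 0 t, Measurable (Y s))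
    (hX : ∀ ω, ContinuousOn (fun s => X s ω) (Icc 0 T)) (hXm : ∀ s ∈ Icc 0 T, Measurable (X s)) :
    Measurable (forwardApprox T ε Y X t) := by
  have hT : 0 ≤ T := ht.1.trans ht.2
  refine Measurable.const_mul (measurable_integral_of_continuousOn ht.1 (fun ω => ?_) ?_) _
  · refine (hY ω).mul (ContinuousOn.sub ?_ ?_)
    · exact (hX ω).comp (by fun_prop : Continuous fun s => min (s + ε) T).continuousOn
        fun s hs => ⟨le_min (add_nonneg hs.1 hε.le) hT, min_le_right _ _⟩
    · exact (hX ω).comp (by fun_prop : Continuous fun s => min s T).continuousOn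
        fun s hs => ⟨le_min hs.1 hT, min_le_right _ _⟩
  · exact fun s hs => (hYm s hs).mul
      ((hXm _ ⟨le_min (add_nonneg hs.1 hε.le) hT, min_le_right _ _⟩).sub
        (hXm _ ⟨le_min hs.1 hT, min_le_right _ _⟩))

theorem tendstoInMeasure_of_subseq_ae {P : Measure Ω} [IsFiniteMeasure P] {f : ℝ → Ω → ℝ}
    {g : Ω → ℝ} (hf : ∀ ε, 0 < ε → Measurable (f ε))
    (hsub : ∀ u : ℕ → ℝ, Tendsto u atTop (𝓝[>] 0) → ∃ ns : ℕ → ℕ, StrictMono ns ∧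
      ∀ᵐ ω ∂P, Tendsto (fun n => f (u (ns n)) ω) atTop (𝓝 (g ω))) :
    TendstoInMeasure P f (𝓝[>] 0) g := by
  intro δ hδ
  refine tendsto_of_subseq_tendsto fun u hu => ?_
  -- Measurability is known only for ε > 0, and the sequence is positive only eventually, hence the
  -- shift by N.
  obtain ⟨N, hN⟩ := eventually_atTop.1 (hu.eventually (self_mem_nhdsWithin (s := Ioi (0 : ℝ))))
  obtain ⟨ns, hns, hae⟩ := hsub (fun n => u (n + N)) (hu.comp (tendsto_add_atTop_nat N))
  exact ⟨fun n => ns n + N, tendstoInMeasure_of_tendsto_ae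
    (fun n => (hf _ (hN _ (Nat.le_add_left _ _))).aestronglyMeasurable) hae δ hδ⟩

/-- Borel–Cantelli with thresholds 1/(k+1) and probabilities below 2^{-k}. The supremum over time
sits inside the event, so one null set serves all times; countable subadditivity suffices, whether
or not the events are measurable. -/
theorem TendstoUcp.exists_subseq_ae {P : Measure Ω} {T : ℝ} {X : ℝ → ℝ → Ω → ℝ} {L : ℝ → Ω → ℝ}
    (h : TendstoUcp P T X L) {u : ℕ → ℝ} (hu : Tendsto u atTop (𝓝[>] 0)) :
    ∃ ns : ℕ → ℕ, StrictMono ns ∧ ∀ᵐ ω ∂P, ∀ t ∈ Icc 0 T,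
      Tendsto (fun n => X (u (ns n)) t ω) atTop (𝓝 (L t ω)) := by
  have h1 : ∀ k : ℕ, ∀ᶠ n in atTop, P {ω | ∃ t ∈ Icc (0 : ℝ) T,
      (1 / ((k : ℝ) + 1)) < |X (u n) t ω - L t ω|} < (1 / 2) ^ k := fun k =>
    ((h _ Nat.one_div_pos_of_nat).comp hu).eventually (gt_mem_nhds (ENNReal.pow_pos (by simp) k))
  obtain ⟨ns, hns, hP⟩ := extraction_forall_of_eventually h1
  refine ⟨ns, hns, ?_⟩
  have h2 : ∑' k : ℕ, P {ω | ∃ t ∈ Icc (0 : ℝ) T,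
      (1 / ((k : ℝ) + 1)) < |X (u (ns k)) t ω - L t ω|} ≠ ⊤ := by
    refine ne_top_of_le_ne_top ?_ (ENNReal.tsum_le_tsum fun k => (hP k).le)
    simp [ENNReal.tsum_geometric]
  have h3 : ∀ᵐ ω ∂P, ∀ᶠ k : ℕ in atTop, ¬ ∃ t ∈ Icc (0 : ℝ) T,
      (1 / ((k : ℝ) + 1)) < |X (u (ns k)) t ω - L t ω| :=
    ae_iff.2 (measure_setOfPred_frequently_eq_zero h2)
  filter_upwards [h3] with ω hω t ht
  rw [tendsto_iff_dist_tendsto_zero]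
  refine squeeze_zero' (Eventually.of_forall fun _ => dist_nonneg) ?_
    tendsto_one_div_add_atTop_nhds_zero_nat
  filter_upwards [hω] with k hk
  push Not at hk
  exact hk t ht

end Measurability

theorem forwardApprox_cutAt {Ω : Type*} {T ε t s : ℝ} (ht : 0 ≤ t) (hs : 0 ≤ s)
    (Y X : ℝ → Ω → ℝ) (ω : Ω) :
    forwardApprox T ε (cutAt Y t) X s ω = forwardApprox T ε Y X (min s t) ω := by
  rw [forwardApprox, forwardApprox,
    ← intervalIntegral.integral_indicator (a₂ := min s t) (a₃ := s) ⟨le_min hs ht, min_le_left _ _⟩]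
  congr 1
  refine intervalIntegral.integral_congr fun w hw => ?_
  rw [uIcc_of_le hs] at hw
  by_cases hwt : w ≤ t
  · simp [cutAt, indicator, hw.1, hwt, hw.2]
  · simp [cutAt, indicator, hwt]

/-! ### Construction and uniqueness of local forward integrals -/

section LocalIntegrals

variable {Ω : Type*} {mΩ : MeasurableSpace Ω} {P : Measure Ω}

theorem isLocalForwardIntegral_of_subseq_ae [IsFiniteMeasure P] {Y X I : ℝ → Ω → ℝ}
    (hY : ∀ ω, ContinuousOn (fun s => Y s ω) (Ico 0 1))
    (hYm : ∀ s ∈ Ico (0 : ℝ) 1, Measurable (Y s))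
    (hX : ∀ ω, ContinuousOn (fun s => X s ω) (Icc 0 1))
    (hXm : ∀ s ∈ Icc (0 : ℝ) 1, Measurable (X s))
    (hI : ∀ ω, ContinuousOn (fun s => I s ω) (Ico 0 1))
    (hsub : ∀ t ∈ Ico (0 : ℝ) 1, ∀ u : ℕ → ℝ, Tendsto u atTop (𝓝[>] 0) → ∃ ns : ℕ → ℕ,
      StrictMono ns ∧
        ∀ᵐ ω ∂P, Tendsto (fun n => forwardApprox 1 (u (ns n)) Y X t ω) atTop (𝓝 (I t ω))) :
    IsLocalForwardIntegral P 1 Y X I := by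
  -- The forward integral of the truncated integrand is I stopped at t.
  refine ⟨hI, fun t ht => ⟨fun s => I (min s t), ⟨hX, fun ω => ?_, fun ω => ?_, fun s hs => ?_⟩,
    ae_of_all _ fun ω s hs => by simp only [min_eq_left hs.2]⟩⟩
  · have h1 : IntegrableOn (fun s => Y s ω) (Icc 0 t) volume :=
      ((hY ω).mono fun s hs => ⟨hs.1, hs.2.trans_lt ht.2⟩).integrableOn_Icc
    exact ((integrable_indicator_iff measurableSet_Icc).2 h1).intervalIntegrable
  · exact (hI ω).comp (by fun_prop : Continuous fun s => min s t).continuousOn fun s hs =>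
      ⟨le_min hs.1 ht.1, (min_le_right _ _).trans_lt ht.2⟩
  · have hst : min s t ∈ Ico (0 : ℝ) 1 := ⟨le_min hs.1 ht.1, (min_le_right _ _).trans_lt ht.2⟩
    have e : (fun ε => forwardApprox 1 ε (cutAt Y t) X s)
        = fun ε => forwardApprox 1 ε Y X (min s t) := by
      ext ε ω
      exact forwardApprox_cutAt ht.1 hs.1 Y X ω
    rw [e]
    exact tendstoInMeasure_of_subseq_ae (fun ε hε => measurable_forwardApprox ⟨hst.1, hst.2.le⟩ hε
      (fun ω => (hY ω).mono fun w hw => ⟨hw.1, hw.2.trans_lt hst.2⟩)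
      (fun w hw => hYm w ⟨hw.1, hw.2.trans_lt hst.2⟩) hX hXm) (hsub _ hst)

/-- Local forward integrals are unique up to indistinguishability. -/
theorem IsLocalForwardIntegral.ae_eq {Y X I I' : ℝ → Ω → ℝ}
    (hI : IsLocalForwardIntegral P 1 Y X I) (hI' : IsLocalForwardIntegral P 1 Y X I') :
    ∀ᵐ ω ∂P, ∀ t ∈ Ico (0 : ℝ) 1, I t ω = I' t ω := by
  -- Limits in probability agree almost surely at each fixed time; countably many rational times and
  -- path continuity remove the dependence of the null set on time.
  have h1 : ∀ q : ℚ, ∀ᵐ ω ∂P, (q : ℝ) ∈ Ico (0 : ℝ) 1 → I q ω = I' q ω := by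
    intro q
    by_cases hq : (q : ℝ) ∈ Ico (0 : ℝ) 1
    · obtain ⟨K, hK, hKI⟩ := hI.2 q hq
      obtain ⟨K', hK', hKI'⟩ := hI'.2 q hq
      filter_upwards [hKI, hKI', tendstoInMeasure_ae_unique
        (hK.tendsto q ⟨hq.1, hq.2.le⟩) (hK'.tendsto q ⟨hq.1, hq.2.le⟩)] with ω e1 e2 e3 _
      rw [← e1 q ⟨hq.1, le_rfl⟩, ← e2 q ⟨hq.1, le_rfl⟩, e3]
    · exact ae_of_all _ fun ω h => absurd h hq
  filter_upwards [ae_all_iff.2 h1] with ω hω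
  have h2 : EqOn (fun t => I t ω) (fun t => I' t ω) (Ioo (0 : ℝ) 1 ∩ range ((↑) : ℚ → ℝ)) := by
    rintro _ ⟨hq, q, rfl⟩
    exact hω q (Ioo_subset_Ico_self hq)
  refine h2.of_subset_closure (hI.1 ω) (hI'.1 ω)
    (inter_subset_left.trans Ioo_subset_Ico_self) ?_
  calc Ico (0 : ℝ) 1 ⊆ closure (Ioo 0 1) := by
        rw [closure_Ioo zero_ne_one]; exact Ico_subset_Icc_self
    _ ⊆ _ := closure_minimal (Rat.denseRange_cast.open_subset_closure_inter isOpen_Ioo)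
      isClosed_closure

end LocalIntegrals

/-! ### Primitives on [0,1) and discounting of the gains -/

theorem continuousOn_primitive_Ico {k : ℝ → ℝ} (hk : ContinuousOn k (Ico 0 1)) :
    ContinuousOn (fun t => ∫ s in (0 : ℝ)..t, k s) (Ico 0 1) := by
  intro t ht
  obtain ⟨T, htT, hT1⟩ := exists_between ht.2
  have hT0 : 0 ≤ T := ht.1.trans htT.le
  have ck : Continuous fun s => k (clamp T s) :=
    (hk.mono fun s hs => ⟨hs.1, hs.2.trans_lt hT1⟩).comp_clamp hT0
  have hcont : Continuous fun t => ∫ s in (0 : ℝ)..t, k (clamp T s) :=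
    intervalIntegral.continuous_primitive (fun a b => ck.intervalIntegrable a b) 0
  have heq : ∀ u ∈ Icc 0 T, ∫ s in (0 : ℝ)..u, k s = ∫ s in (0 : ℝ)..u, k (clamp T s) :=
    fun u hu => intervalIntegral.integral_congr fun s hs => by
      rw [uIcc_of_le hu.1] at hs
      simp only [clamp_of_mem (⟨hs.1, hs.2.trans hu.2⟩ : s ∈ Icc 0 T)]
  refine hcont.continuousWithinAt.congr_of_eventuallyEq ?_ (heq t ⟨ht.1, htT.le⟩)
  filter_upwards [self_mem_nhdsWithin, mem_nhdsWithin_of_mem_nhds (Iio_mem_nhds htT)] with u hu hu'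
  exact heq u ⟨hu.1, le_of_lt hu'⟩

theorem tendsto_integral_left_of_continuousOn {k : ℝ → ℝ} (hk : ContinuousOn k (Icc 0 1)) :
    Tendsto (fun t => ∫ s in (0 : ℝ)..t, k s) (𝓝[<] 1) (𝓝 (∫ s in (0 : ℝ)..1, k s)) := by
  have ck : Continuous fun s => k (clamp 1 s) := hk.comp_clamp zero_le_one
  have hcont : Continuous fun t => ∫ s in (0 : ℝ)..t, k (clamp 1 s) :=
    intervalIntegral.continuous_primitive (fun a b => ck.intervalIntegrable a b) 0
  have heq : ∀ u ∈ Icc (0 : ℝ) 1, ∫ s in (0 : ℝ)..u, k (clamp 1 s) = ∫ s in (0 : ℝ)..u, k s :=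
    fun u hu => intervalIntegral.integral_congr fun s hs => by
      rw [uIcc_of_le hu.1] at hs
      simp only [clamp_of_mem (⟨hs.1, hs.2.trans hu.2⟩ : s ∈ Icc (0 : ℝ) 1)]
  rw [← heq 1 (by simp)]
  refine ((hcont.tendsto 1).mono_left nhdsWithin_le_nhds).congr' ?_
  filter_upwards [Ioo_mem_nhdsLT (zero_lt_one' ℝ)] with u hu
  exact heq u (Ioo_subset_Icc_self hu)

/-- Discounting the forward integral `Z`, when `v(t, S̃_t)` is denoted by `V_t`. -/
theorem tendsto_forwardApprox_discount {Ω : Type*} {r T t : ℝ} (hT : T < 1) (ht : t ∈ Icc 0 T)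
    {V k : ℝ → ℝ} (hV : ContinuousOn V (Ico 0 1)) (hk : ContinuousOn k (Ico 0 1))
    {Z : ℝ → Ω → ℝ} {ω : Ω}
    (hZ : ∀ s, Z s ω = Real.exp (r * s) * V s - V 0
      - r * (∫ u in (0 : ℝ)..s, Real.exp (r * u) * V u) + r * ∫ u in (0 : ℝ)..s, k u) :
    Tendsto (fun ε => forwardApprox T ε (fun s _ => Real.exp (-(r * s))) Z t ω) (𝓝[>] 0)
      (𝓝 (V t - V 0 + r * ∫ s in (0 : ℝ)..t, Real.exp (-(r * s)) * k s)) := by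
  have hTsub : Icc 0 T ⊆ Ico (0 : ℝ) 1 := fun s hs => ⟨hs.1, hs.2.trans_lt hT⟩
  have htsub : Icc 0 t ⊆ Ico (0 : ℝ) 1 := (Icc_subset_Icc_right ht.2).trans hTsub
  have cE : ∀ {A : Set ℝ} (c : ℝ), ContinuousOn (fun s : ℝ => Real.exp (c * s)) A := fun c =>
    Continuous.continuousOn (by fun_prop)
  have hEV : ContinuousOn (fun u => Real.exp (r * u) * V u) (Ico 0 1) := (cE r).mul hV
  have hEV' := continuousOn_primitive_Ico hEV
  have hk' := continuousOn_primitive_Ico hk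
  have hZc : ContinuousOn (fun s => Z s ω) (Icc 0 T) := by
    simp only [hZ]
    exact ((((hEV.sub continuousOn_const).sub (hEV'.const_mul r)).add (hk'.const_mul r))).mono hTsub
  have main := tendsto_forwardApprox_exp (c := -r) ht hZc
  simp only [neg_mul] at main
  convert! main using 2
  have i : ∀ {f : ℝ → ℝ}, ContinuousOn f (Ico 0 1) → IntervalIntegrable f volume 0 t := fun hf =>
    ContinuousOn.intervalIntegrable (by rw [uIcc_of_le ht.1]; exact hf.mono htsub)
  have cE' : ∀ {A : Set ℝ}, ContinuousOn (fun s : ℝ => Real.exp (-(r * s))) A :=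
    Continuous.continuousOn (by fun_prop)
  -- Both iterated integrals in Z are undone by parts: the first becomes ∫ V, which cancels the ∫ V
  -- from the leading term of Z, and the second becomes ∫ e^{-rs} k, which survives.
  have p1 := integral_exp_mul_primitive ht.1 (hEV.mono htsub) (-r)
  have p2 := integral_exp_mul_primitive ht.1 (hk.mono htsub) (-r)
  have hcancel : ∀ s, Real.exp (-(r * s)) * (Real.exp (r * s) * V s) = V s := fun s => by
    rw [← mul_assoc, ← Real.exp_add]
    simp
  have hexp : r * ∫ s in (0 : ℝ)..t, Real.exp (-(r * s)) = 1 - Real.exp (-(r * t)) := by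
    rw [← intervalIntegral.integral_const_mul]
    have := intervalIntegral.integral_eq_sub_of_hasDerivAt (a := 0) (b := t)
      (f := fun s => -Real.exp (-(r * s))) (f' := fun s => r * Real.exp (-(r * s)))
      (fun s _ => by
        convert! (((hasDerivAt_id s).const_mul r).neg.exp).neg using 1
        simp [mul_comm])
      (Continuous.intervalIntegrable (by fun_prop) _ _)
    rw [this]
    simp
    ring
  simp only [neg_mul, hcancel] at p1 p2
  have hsplit : ∫ s in (0 : ℝ)..t, Real.exp (-(r * s)) * Z s ω
      = (∫ s in (0 : ℝ)..t, V s) - V 0 * (∫ s in (0 : ℝ)..t, Real.exp (-(r * s)))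
        - r * (∫ s in (0 : ℝ)..t, Real.exp (-(r * s)) * ∫ u in (0 : ℝ)..s, Real.exp (r * u) * V u)
        + r * ∫ s in (0 : ℝ)..t, Real.exp (-(r * s)) * ∫ u in (0 : ℝ)..s, k u := by
    rw [← intervalIntegral.integral_const_mul, ← intervalIntegral.integral_const_mul,
      ← intervalIntegral.integral_const_mul, ← intervalIntegral.integral_sub,
      ← intervalIntegral.integral_sub, ← intervalIntegral.integral_add]
    · refine intervalIntegral.integral_congr fun s _ => ?_
      simp only [hZ]
      linear_combination hcancel s
    · exact i ((hV.sub (cE'.const_mul _)).sub ((cE'.mul hEV').const_mul r))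
    · exact i ((cE'.mul hk').const_mul r)
    · exact i (hV.sub (cE'.const_mul _))
    · exact i ((cE'.mul hEV').const_mul r)
    · exact i hV
    · exact i (cE'.const_mul _)
  rw [hsplit, hZ, hZ 0]
  simp only [mul_zero, Real.exp_zero, intervalIntegral.integral_same, one_mul, sub_self, sub_zero,
    add_zero]
  linear_combination (-1 : ℝ) * hcancel t + r * p1 - r * p2 + V 0 * hexp

end ForwardCalculus

/-! ### The hedging portfolio and its improper integrals -/

theorem propositionp5p31 {Ω : Type*} {mΩ : MeasurableSpace Ω} (P : Measure Ω) [IsProbabilityMeasure P]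
    (𝓖 : Filtration (Icc (0 : ℝ) 1) mΩ)
    (r : ℝ) (hr : 0 < r)
    -- the price process: adapted, continuous, strictly positive
    (S : ℝ → Ω → ℝ)
    (hS_adapted : ∀ t : Icc (0 : ℝ) 1, Measurable[𝓖 t] (S t))
    (hS_cont : ∀ ω, ContinuousOn (fun t => S t ω) (Icc 0 1))
    (hS_pos : ∀ t ∈ Icc (0 : ℝ) 1, ∀ ω, 0 < S t ω)
    -- `d[S]_t = σ(t,S_t)² S_t² dt`; only the values of `σ` on `[0,1] × (0,∞)` matter
    (σ : ℝ → ℝ → ℝ)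
    (hσ_int : ∀ᵐ ω ∂P,
      IntervalIntegrable (fun s => σ s (S s ω) ^ 2 * S s ω ^ 2) volume 0 1)
    (hS_qv : ForwardCalculus.IsCovariation P 1 S S
      (fun t ω => ∫ s in (0 : ℝ)..t, σ s (S s ω) ^ 2 * S s ω ^ 2))
    (ψ : ℝ → ℝ) (hψ : Continuous ψ)
    -- the solution of the terminal value problem
    (v : ℝ → ℝ → ℝ)
    (hv_C12 : ForwardCalculus.IsC12 v)
    (hv_cont : ContinuousOn (fun p : ℝ × ℝ => v p.1 p.2) (Icc 0 1 ×ˢ univ))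
    (hv_pde : ∀ t ∈ Ico (0 : ℝ) 1, ∀ y : ℝ, 0 < y →
      ForwardCalculus.dt v t y
        + 1 / 2 * σ t (y * Real.exp (r * t)) ^ 2 * y ^ 2 * ForwardCalculus.dyy v t y = 0)
    (hv_terminal : ∀ y : ℝ, v 1 y = ψ (y * Real.exp r) * Real.exp (-r))
    -- the strategy `h_t = ∂_y v(t, S̃_t)` and the initial capital `X₀ = v(0, S₀)`
    (h : ℝ → Ω → ℝ)
    (hh : ∀ t ∈ Ico (0 : ℝ) 1, ∀ ω,
      h t ω = ForwardCalculus.dy v t (ForwardCalculus.discounted r S t ω))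
    (X₀ : Ω → ℝ) (hX₀ : ∀ ω, X₀ ω = v 0 (S 0 ω)) :
    ForwardCalculus.IsSelfFinancingPortfolio P 𝓖 S X₀ h ∧
    ForwardCalculus.Replicates P r S X₀ h (fun ω => ψ (S 1 ω)) ∧
    ForwardCalculus.ImproperlyForwardIntegrable P 1 h (ForwardCalculus.discounted r S) ∧
    (ForwardCalculus.ImproperlyForwardIntegrable P 1 h S ↔
      ∀ᵐ ω ∂P, ∃ l : ℝ,
        Tendsto (fun t => ∫ s in (0 : ℝ)..t, h s ω * S s ω) (𝓝[<] 1) (𝓝 l)) := by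
  have hcS : ∀ ω, ContinuousOn (fun t => ForwardCalculus.discounted r S t ω) (Icc 0 1) := fun ω =>
    (Continuous.continuousOn (by fun_prop : Continuous fun t : ℝ => Real.exp (-(r * t)))).mul
      (hS_cont ω)
  have hSm : ∀ t ∈ Icc (0 : ℝ) 1, Measurable (S t) := fun t ht =>
    (hS_adapted ⟨t, ht⟩).mono (𝓖.le _) le_rfl
  have hcSm : ∀ t ∈ Icc (0 : ℝ) 1, Measurable (ForwardCalculus.discounted r S t) := fun t ht =>
    (hSm t ht).const_mul _
  have hdy : ∀ t ∈ Ico (0 : ℝ) 1, Continuous (ForwardCalculus.dy v t) := fun t ht =>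
    (hv_C12.differentiable_yy t ht).continuous
  have hd0 : ∀ ω, ForwardCalculus.discounted r S 0 ω = S 0 ω := fun ω => by
    simp [ForwardCalculus.discounted]
  have hS_eq : ∀ t ω, S t ω = Real.exp (r * t) * ForwardCalculus.discounted r S t ω := fun t ω => by
    rw [ForwardCalculus.discounted, ← mul_assoc, ← Real.exp_add]
    simp
  -- the discounted value process of the claim
  set V : ℝ → Ω → ℝ := fun t ω => v t (ForwardCalculus.discounted r S t ω) with hVdef
  have hV1 : ∀ ω, ContinuousOn (fun t => V t ω) (Icc 0 1) := fun ω =>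
    hv_cont.comp (f := fun t => (t, ForwardCalculus.discounted r S t ω))
      (continuousOn_id.prodMk (hcS ω)) fun t ht => ⟨ht, mem_univ _⟩
  have hV : ∀ ω, ContinuousOn (fun t => V t ω) (Ico 0 1) := fun ω =>
    (hV1 ω).mono Ico_subset_Icc_self
  have hV0 : ∀ ω, V 0 ω = v 0 (S 0 ω) := fun ω => by simp only [hVdef, hd0]
  have hVlim : ∀ ω, Tendsto (fun t => V t ω) (𝓝[<] 1) (𝓝 (ψ (S 1 ω) * Real.exp (-r))) := fun ω => by
    have h1 : V 1 ω = ψ (S 1 ω) * Real.exp (-r) := by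
      simp only [hVdef]
      rw [hv_terminal, hS_eq 1 ω, mul_one, mul_comm (Real.exp r)]
    rw [← h1]
    refine (hV1 ω 1 ⟨zero_le_one, le_rfl⟩).mono_left ?_
    rw [← nhdsWithin_Ico_eq_nhdsLT (zero_lt_one' ℝ)]
    exact nhdsWithin_mono _ Ico_subset_Icc_self
  have hhc : ∀ ω, ContinuousOn (fun t => h t ω) (Ico 0 1) := fun ω =>
    (hv_C12.continuousOn_dy.comp (f := fun t => (t, ForwardCalculus.discounted r S t ω))
      (continuousOn_id.prodMk ((hcS ω).mono Ico_subset_Icc_self))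
      fun t ht => ⟨ht, mem_univ _⟩).congr fun t ht => hh t ht ω
  have hhm : ∀ t ∈ Ico (0 : ℝ) 1, Measurable (h t) := fun t ht => by
    rw [funext (hh t ht)]
    exact (hdy t ht).measurable.comp (hcSm t ⟨ht.1, ht.2.le⟩)
  have hhS : ∀ ω, ContinuousOn (fun t => h t ω * S t ω) (Ico 0 1) := fun ω =>
    (hhc ω).mul ((hS_cont ω).mono Ico_subset_Icc_self)
  have hEV : ∀ ω, ContinuousOn (fun t => Real.exp (r * t) * V t ω) (Icc 0 1) := fun ω =>
    (Continuous.continuousOn (by fun_prop : Continuous fun t : ℝ => Real.exp (r * t))).mul (hV1 ω)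
  -- the forward integral of `h` against `S`
  set Z : ℝ → Ω → ℝ := fun t ω => Real.exp (r * t) * V t ω - V 0 ω
    - r * (∫ s in (0 : ℝ)..t, Real.exp (r * s) * V s ω)
    + r * ∫ s in (0 : ℝ)..t, h s ω * S s ω with hZdef
  have hZc : ∀ ω, ContinuousOn (fun t => Z t ω) (Ico 0 1) := fun ω => by
    have hE := (hEV ω).mono Ico_subset_Icc_self
    exact ((hE.sub continuousOn_const).sub
      ((ForwardCalculus.continuousOn_primitive_Ico hE).const_mul r)).add
      ((ForwardCalculus.continuousOn_primitive_Ico (hhS ω)).const_mul r)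
  have hZm : ∀ t ∈ Ico (0 : ℝ) 1, Measurable (Z t) := fun t ht => by
    have hVm : ∀ s ∈ Ico (0 : ℝ) 1, Measurable (V s) := fun s hs =>
      (hv_C12.differentiable_y s hs).continuous.measurable.comp (hcSm s ⟨hs.1, hs.2.le⟩)
    have hsub : Icc 0 t ⊆ Ico (0 : ℝ) 1 := fun s hs => ⟨hs.1, hs.2.trans_lt ht.2⟩
    refine ((((hVm t ht).const_mul _).sub (hVm 0 ⟨le_rfl, zero_lt_one⟩)).sub
      (Measurable.const_mul ?_ r)).add (Measurable.const_mul ?_ r)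
    · exact ForwardCalculus.measurable_integral_of_continuousOn ht.1
        (fun ω => (hEV ω).mono (hsub.trans Ico_subset_Icc_self))
        fun s hs => (hVm s (hsub hs)).const_mul _
    · exact ForwardCalculus.measurable_integral_of_continuousOn ht.1 (fun ω => (hhS ω).mono hsub)
        fun s hs => (hhm s (hsub hs)).mul (hSm s ⟨hs.1, (hsub hs).2.le⟩)
  -- the Itô formula, almost surely along subsequences
  have ito : ∀ u : ℕ → ℝ, Tendsto u atTop (𝓝[>] 0) → ∃ ns : ℕ → ℕ, StrictMono ns ∧
      ∀ᵐ ω ∂P, ∀ t ∈ Ico (0 : ℝ) 1,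
        Tendsto (fun n => ForwardCalculus.forwardApprox 1 (u (ns n)) h
          (ForwardCalculus.discounted r S) t ω) atTop (𝓝 (V t ω - V 0 ω)) ∧
        Tendsto (fun n => ForwardCalculus.forwardApprox 1 (u (ns n)) h S t ω) atTop
          (𝓝 (Z t ω)) := by
    intro u hu
    obtain ⟨ns, hns, hae⟩ := ForwardCalculus.TendstoUcp.exists_subseq_ae hS_qv hu
    refine ⟨ns, hns, ?_⟩
    filter_upwards [hae, hσ_int] with ω hω hint t ht
    have := ForwardCalculus.tendsto_forwardApprox_of_path (l := map (fun n => u (ns n)) atTop)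
      (hu.comp hns.tendsto_atTop) (hS_cont ω) hint (fun s => by positivity)
      (fun w hw => tendsto_map'_iff.2 (hω w hw)) hv_C12 (r := r)
      -- The backward equation is used at y = S̃_s > 0, where y e^{rs} = S_s turns σ̃ into σ(s,
      -- S_s).
      (fun s hs => by
        have h1 := hv_pde s hs (ForwardCalculus.discounted r S s ω)
          (mul_pos (Real.exp_pos _) (hS_pos s ⟨hs.1, hs.2.le⟩ ω))
        rw [mul_comm _ (Real.exp (r * s)), ← hS_eq] at h1
        have h2 : Real.exp (-r * s) ^ 2 * (σ s (S s ω) ^ 2 * S s ω ^ 2)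
            = σ s (S s ω) ^ 2 * ForwardCalculus.discounted r S s ω ^ 2 := by
          rw [ForwardCalculus.discounted, neg_mul]
          ring
        rw [h2, ← h1]
        ring)
      (fun s hs => hh s hs ω) ht
    rw [← hV0] at this
    exact ⟨tendsto_map'_iff.1 this.1, tendsto_map'_iff.1 this.2⟩
  have locZ : ForwardCalculus.IsLocalForwardIntegral P 1 h S Z :=
    ForwardCalculus.isLocalForwardIntegral_of_subseq_ae hhc hhm hS_cont hSm hZc fun t ht u hu => by
      obtain ⟨ns, hns, hae⟩ := ito u hu
      exact ⟨ns, hns, hae.mono fun ω hω => (hω t ht).2⟩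
  have locV : ForwardCalculus.IsLocalForwardIntegral P 1 h (ForwardCalculus.discounted r S)
      (fun t ω => V t ω - V 0 ω) :=
    ForwardCalculus.isLocalForwardIntegral_of_subseq_ae hhc hhm hcS hcSm
      (fun ω => (hV ω).sub continuousOn_const) fun t ht u hu => by
        obtain ⟨ns, hns, hae⟩ := ito u hu
        exact ⟨ns, hns, hae.mono fun ω hω => (hω t ht).1⟩
  refine ⟨⟨?_, ?_, ?_, Z, locZ⟩, ?_, ⟨_, locV, ?_⟩, ?_⟩
  · rw [funext hX₀]
    exact (hv_C12.differentiable_y 0 ⟨le_rfl, zero_lt_one⟩).continuous.measurable.comp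
      (hS_adapted ⟨0, by simp⟩)
  · intro t ht
    rw [funext (hh t ⟨t.2.1, ht⟩)]
    exact (hdy t ⟨t.2.1, ht⟩).measurable.comp ((hS_adapted t).const_mul _)
  · intro ω
    refine ⟨fun t ht => (hhc ω t ht).mono fun s hs => ⟨hs.1, hs.2.trans_lt ht.2⟩, fun T hT => ?_⟩
    exact isCompact_Icc.exists_bound_of_continuousOn
      ((hhc ω).mono fun s hs => ⟨hs.1, hs.2.trans_lt hT.2⟩)
  -- The wealth is e^{rt} V_t; the second witness is the integral of e^{-rs} against Z.
  · refine ⟨fun t ω => Real.exp (r * t) * V t ω, ⟨Z, fun t ω => V t ω - V 0 ω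
      + r * ∫ s in (0 : ℝ)..t, Real.exp (-(r * s)) * (h s ω * S s ω), locZ, fun T hT => ?_, ?_⟩, ?_⟩
    · have hsub : Icc 0 T ⊆ Ico (0 : ℝ) 1 := fun s hs => ⟨hs.1, hs.2.trans_lt hT.2⟩
      have hE : Continuous fun s : ℝ => Real.exp (-(r * s)) := by fun_prop
      refine ⟨fun ω => (hZc ω).mono hsub, fun ω => hE.intervalIntegrable _ _, fun ω => ?_,
        fun t ht => ?_⟩
      · exact (((hV ω).sub continuousOn_const).add ((ForwardCalculus.continuousOn_primitive_Ico
          (hE.continuousOn.mul (hhS ω))).const_mul r)).mono hsub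
      -- The integrator is continuous and the integrand smooth, so convergence holds on every path
      -- and no subsequence has to be extracted.
      · refine ForwardCalculus.tendstoInMeasure_of_subseq_ae
          (fun ε hε => ForwardCalculus.measurable_forwardApprox ht hε (fun ω => hE.continuousOn)
            (fun s _ => measurable_const) (fun ω => (hZc ω).mono hsub)
            fun s hs => hZm s (hsub hs)) fun u hu => ⟨id, strictMono_id, ae_of_all _ fun ω => ?_⟩
        exact (ForwardCalculus.tendsto_forwardApprox_discount hT.2 ht (hV ω) (hhS ω)
          fun s => rfl).comp hu
    · refine ae_of_all _ fun ω t _ => ?_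
      have e : ∫ s in (0 : ℝ)..t, Real.exp (-(r * s)) * h s ω * S s ω * r
          = r * ∫ s in (0 : ℝ)..t, Real.exp (-(r * s)) * (h s ω * S s ω) := by
        rw [← intervalIntegral.integral_const_mul]
        exact intervalIntegral.integral_congr fun s _ => by ring
      rw [e, hX₀, ← hV0, ForwardCalculus.discounted, ← mul_assoc, ← Real.exp_add]
      simp
    · refine ae_of_all _ fun ω => ?_
      have h1 : Tendsto (fun t : ℝ => Real.exp (r * t)) (𝓝[<] 1) (𝓝 (Real.exp r)) := by
        simpa using ((by fun_prop : Continuous fun t : ℝ => Real.exp (r * t)).tendsto 1).mono_left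
          nhdsWithin_le_nhds
      convert! h1.mul (hVlim ω) using 2
      rw [mul_left_comm, ← Real.exp_add]
      simp
  · exact ae_of_all _ fun ω => ⟨_, (hVlim ω).sub_const _⟩
  · have hElim : ∀ ω, ∃ l, Tendsto (fun t => Real.exp (r * t) * V t ω - V 0 ω
        - r * ∫ s in (0 : ℝ)..t, Real.exp (r * s) * V s ω) (𝓝[<] 1) (𝓝 l) := fun ω => by
      have h1 := ((by fun_prop : Continuous fun t : ℝ => Real.exp (r * t)).tendsto 1).mono_left
        (nhdsWithin_le_nhds (s := Iio 1))
      exact ⟨_, ((h1.mul (hVlim ω)).sub_const _).sub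
        ((ForwardCalculus.tendsto_integral_left_of_continuousOn (hEV ω)).const_mul r)⟩
    constructor
    · rintro ⟨I, hI, hlim⟩
      -- The given I may be another version of the integral; uniqueness identifies it with Z, and r
      -- ∫ h S is Z minus its convergent part.
      filter_upwards [hlim, hI.ae_eq locZ] with ω ⟨l, hl⟩ hIZ
      obtain ⟨m, hm⟩ := hElim ω
      refine ⟨(l - m) / r, ((hl.sub hm).div_const r).congr' ?_⟩
      filter_upwards [Ioo_mem_nhdsLT (zero_lt_one' ℝ)] with t ht
      rw [hIZ t (Ioo_subset_Ico_self ht), hZdef]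
      field_simp
      ring
    · intro hlim
      refine ⟨Z, locZ, hlim.mono fun ω ⟨l, hl⟩ => ?_⟩
      obtain ⟨m, hm⟩ := hElim ω
      exact ⟨_, hm.add (hl.const_mul r)⟩
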